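/- Let $n\ge 1$. A \emph{rearrangement invariant (r.i.) space} $X$ on a $\sigma$-finite measure space $(\Omega,\mu)$ is the space of all real measurable $f$ with $\|f\|_X=\rho(|f|)<\infty$, where $\rho$ is a Banach function norm, i.e. a map from the measurable functions $\Omega\to[0,\infty]$ to $[0,\infty]$ such that, for all measurable $f,g,f_k:\Omega\to[0,\infty]$, $a\ge 0$, and measurable $E$ with $\mu(E)<\infty$: $\rho(f)=0$ iff $f=0$ a.e.; $\rho(af)=a\rho(f)$; $\rho(f+g)\le\rho(f)+\rho(g)$; $f\le g$ a.e. implies $\rho(f)\le\rho(g)$; $f_k\uparrow f$ a.e. implies $\rho(f_k)\uparrow\rho(f)$; $\rho(\chi_E)<\infty$; and $\int_E f\,d\mu\le C_E\,\rho(f)$ with a finite constant $C_E$ independent of $f$; and moreover $\rho(f)=\rho(g)$ whenever $f^*=g^*$. Here $f^*(t)=\inf\{s\ge 0:\mu(\{|f|>s\})\le t\}$, $t\ge0$, is the non-increasing rearrangement of $f$. Every r.i. space $X$ on $\mathbb{R}^n$ (with Lebesgue measure) has a representation, i.e. an r.i. space $\bar X$ on $(0,\infty)$ such that $\|f\|_X=\|f^*\|_{\bar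 X}$ for every measurable $f$. For $f\in L^1_{\rm loc}(\mathbb{R}^n)$ let $\mathcal M f(x)=\sup_{r>0}\frac1{|B_r|}\int_{B_r}|f(x-y)|\,dy$ be the centered Hardy–Littlewood maximal function, where $B_r$ is the Euclidean ball of radius $r$ centered at $0$. A non-constant fixed point of $\mathcal M$ is a function $f\in L^1_{\rm loc}(\mathbb{R}^n)$ with $\mathcal Mf=f$ a.e. that is not a.e. equal to a constant. For $1\le p<\infty$ let $L^{p,\infty}(\mathbb{R}^n)$ be the space of measurable $f$ with $\sup_{t>0}t^{1/p}f^*(t)<\infty$. For measurable $g\ge 0$ let $I_2g(x)=\int_{\mathbb{R}^n}|x-y|^{2-n}g(y)\,dy$, and let $D_{I_2}(X)$ be the set of measurable $f:\mathbb{R}^n\to\mathbb{R}$ (modulo equality a.e.) with $\|I_2|f|\|_X<\infty$. **Theorem.** For every r.i. space $X$ on $\mathbb{R}^n$ with representation $\bar X$ the following are equivalent: 1. $X$ contains a non-constant fixed point of $\mathcal M$; 2. $n\ge3$ and $|x|^{2-n}\chi_{\{|x|>1\}}(x)\in X$; 3. $n\ge3$ and $\chi_{[0,1]}(t)+t^{2/n-1}\chi_{[1,\infty)}(t)\in\bar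 X$; 4. $n\ge3$ and $L^{\frac n{n-2},\infty}(\mathbb{R}^n)\cap L^\infty(\mathbb{R}^n)\subset X$; 5. $n\ge3$ and $D_{I_2}(X)\ne\{0\}$. In particular, if $n\ge3$, then $L^{\frac n{n-2},\infty}(\mathbb{R}^n)\cap L^\infty(\mathbb{R}^n)$ is the minimal r.i. space containing a non-constant fixed point of $\mathcal M$: it is (as a set of functions) an r.i. space, it contains a non-constant fixed point, and it is contained in every r.i. space on $\mathbb{R}^n$ that contains one. -/

import Mathlib

open MeasureTheory Set
open scoped ENNReal NNReal

/-- The non-increasing, right-continuous rearrangement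
`f^*(t) = inf {s : μ {f > s} ≤ t}` of a `[0, ∞]`-valued function (relevant for `t ≥ 0`). -/
noncomputable def rearrangement {α : Type*} [MeasurableSpace α] (μ : Measure α)
    (f : α → ℝ≥0∞) (t : ℝ) : ℝ≥0∞ :=
  sInf {s : ℝ≥0∞ | μ {x | s < f x} ≤ ENNReal.ofReal t}

/-- A Banach function norm: a map on the `[0, ∞]`-valued (a.e.-)measurable functions with the
usual five axioms (norm, lattice property, Fatou property, indicator functions of sets of finite
measure have finite norm, local integrability). -/
structure BanachFunctionNorm {α : Type*} [MeasurableSpace α] (μ : Measure α) where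
  /-- the function norm -/
  toFun : (α → ℝ≥0∞) → ℝ≥0∞
  eq_zero_iff : ∀ f, AEMeasurable f μ → (toFun f = 0 ↔ f =ᵐ[μ] 0)
  smul : ∀ (a : ℝ≥0) (f), AEMeasurable f μ → toFun (fun x => a * f x) = a * toFun f
  add_le : ∀ f g, AEMeasurable f μ → AEMeasurable g μ →
    toFun (fun x => f x + g x) ≤ toFun f + toFun g
  mono : ∀ f g, AEMeasurable f μ → AEMeasurable g μ → f ≤ᵐ[μ] g → toFun f ≤ toFun g
  fatou : ∀ f : ℕ → α → ℝ≥0∞, (∀ k, AEMeasurable (f k) μ) →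
    (∀ᵐ x ∂μ, Monotone fun k => f k x) → toFun (fun x => ⨆ k, f k x) = ⨆ k, toFun (f k)
  indicator_lt_top : ∀ s, MeasurableSet s → μ s < ∞ → toFun (s.indicator fun _ => 1) < ∞
  setLIntegral_le : ∀ s, MeasurableSet s → μ s < ∞ →
    ∃ C : ℝ≥0, ∀ f, AEMeasurable f μ → ∫⁻ x in s, f x ∂μ ≤ C * toFun f

/-- A rearrangement invariant Banach function norm. The associated r.i. space is the set of
functions satisfying `RINorm.Mem`. -/
structure RINorm {α : Type*} [MeasurableSpace α] (μ : Measure α) extends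
    BanachFunctionNorm μ where
  rearrangement_invariant : ∀ f g, AEMeasurable f μ → AEMeasurable g μ →
    rearrangement μ f = rearrangement μ g → toFun f = toFun g

/-- `f` belongs to the r.i. space `X` with norm `‖f‖_X = ρ(|f|)`. -/
def RINorm.Mem {α : Type*} [MeasurableSpace α] {μ : Measure α} (X : RINorm μ) (f : α → ℝ) :
    Prop :=
  AEStronglyMeasurable f μ ∧ X.toFun (fun x => ‖f x‖ₑ) < ∞

/-- Lebesgue measure on the half-line `(0, ∞)`. -/
noncomputable def volumeHalfLine : Measure ℝ := volume.restrict (Ioi 0)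

/-- `Xbar` is the representation on `(0, ∞)` of the r.i. space `X`: `‖f‖_X = ‖f^*‖_Xbar`. -/
def IsRepresentation {α : Type*} [MeasurableSpace α] {μ : Measure α} (X : RINorm μ)
    (Xbar : RINorm volumeHalfLine) : Prop :=
  ∀ f, AEMeasurable f μ → X.toFun f = Xbar.toFun (rearrangement μ f)

/-- `f` belongs to weak `L^p`, that is, `sup_{t > 0} t^{1/p} f^*(t) < ∞`. -/
def MemWeakLp {α : Type*} [MeasurableSpace α] (f : α → ℝ) (p : ℝ) (μ : Measure α) : Prop :=
  AEStronglyMeasurable f μ ∧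
    ⨆ (t : ℝ) (_ : 0 < t),
      ENNReal.ofReal (t ^ (1 / p)) * rearrangement μ (fun x => ‖f x‖ₑ) t < ∞

/-- The centered Hardy-Littlewood maximal operator. -/
noncomputable def centeredMaximal {n : ℕ} (f : EuclideanSpace ℝ (Fin n) → ℝ)
    (x : EuclideanSpace ℝ (Fin n)) : ℝ≥0∞ :=
  ⨆ (r : ℝ) (_ : 0 < r),
    (volume (Metric.ball (0 : EuclideanSpace ℝ (Fin n)) r))⁻¹ *
      ∫⁻ y in Metric.ball (0 : EuclideanSpace ℝ (Fin n)) r, ‖f (x - y)‖ₑ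

/-- `f ∈ L^1_loc` satisfies `M f = f` a.e. (an equality of extended real numbers) and is not
a.e. equal to a constant. -/
def IsNonconstantFixedPoint {n : ℕ} (f : EuclideanSpace ℝ (Fin n) → ℝ) : Prop :=
  LocallyIntegrable f volume ∧
    (∀ᵐ x, ((centeredMaximal f x : ℝ≥0∞) : EReal) = ((f x : ℝ) : EReal)) ∧
    ¬ ∃ c : ℝ, f =ᵐ[volume] fun _ => c

/-- The Riesz potential `I_2 g (x) = ∫ |x - y|^{2-n} g(y) dy` of a non-negative function. -/
noncomputable def rieszPotential {n : ℕ} (g : EuclideanSpace ℝ (Fin n) → ℝ≥0∞)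
    (x : EuclideanSpace ℝ (Fin n)) : ℝ≥0∞ :=
  ∫⁻ y, ENNReal.ofReal (‖x - y‖ ^ (2 - (n : ℝ))) * g y

/-- The domain `D_{I_2}(X)`: the (classes of) measurable functions `f` with
`‖I_2 |f|‖_X < ∞`. -/
def rieszDomain {n : ℕ} (X : RINorm (volume : Measure (EuclideanSpace ℝ (Fin n)))) :
    Set (EuclideanSpace ℝ (Fin n) →ₘ[volume] ℝ) :=
  {f | X.toFun (rieszPotential fun y => ‖f y‖ₑ) < ∞}

/-!
All conditions are compared with one another through the single statement that the function
`(1 + ‖x‖²)^{(2-n)/2}` (`newtonProfile`) has finite norm in `X`. Up to a bounded function on a ball,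
which every r.i. space contains, it is the fundamental solution `‖x‖^{2-n}` of the Laplacian.

*Representation.* The map sending `x` to the volume of the ball of radius `‖x‖` preserves measure
from `ℝⁿ` to the half-line (`measurePreserving_ballVolume`). Composition with it turns a function
norm on `ℝⁿ` into one on `(0, ∞)`, and since `f` and `f^* ∘ σ` are equimeasurable this is a
representation (`isRepresentation_map`).

*Existence of a fixed point.* The function `(1 + ‖x‖²)^{(2-n)/2}` has negative Laplacian if `n ≥ 3`.
Differentiating the average over the ball of radius `r` in `r` and integrating by parts against
`(1 - ‖y‖²)₊ / 2` shows that the averages decrease in `r`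
(`mul_lt_setIntegral_ball_of_divergence_pos`). Hence the function dominates all its ball averages,
and it is a fixed point (`isNonconstantFixedPoint_regPower`).

*Lower bound for fixed points.* If `f` is a fixed point, then its maximal function `U` equals `f`
almost everywhere, is lower semicontinuous, and dominates its ball averages at every point
(`IsNonconstantFixedPoint.superMean`). Comparison with the strictly subharmonic barriers
`(ε + ‖x‖²)^{-b}`, `2b > n - 2`, `b > 0`, on an annulus, and a passage to the limit in `ε` and `b`,
give `U x ≥ m (δ / ‖x - z‖)^{2b}` with `2b = max 0 (n - 2)` whenever `U ≥ m` on the sphere of radius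
`δ` around `z` (`SuperMean.lower_bound`). For `n ≤ 2` this makes `U` constant; for `n ≥ 3` it shows
that `f` dominates a multiple of `‖x‖^{2-n}` near infinity.

*Minimal space.* The intersection of weak `L^{n/(n-2)}` with `L^∞` is normed by
`sup_t (t⁻¹ + t^{1/p-1}) ∫_0^t f^*` (`weakLpInter`). The triangle inequality follows from
`∫_0^t f^* = min_s (t s + ∫ (f - s)₊)`.
-/

/-! ### Rearrangements -/

section Rearrangement

variable {α β : Type*} [MeasurableSpace α] [MeasurableSpace β] {μ : Measure α} {ν : Measure β}

theorem rearrangement_mono {f g : α → ℝ≥0∞} (h : f ≤ᵐ[μ] g) (t : ℝ) :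
    rearrangement μ f t ≤ rearrangement μ g t := by
  refine sInf_le_sInf fun s hs => ?_
  refine le_trans (measure_mono_ae ?_) hs
  filter_upwards [h] with x hx hsx
  exact lt_of_lt_of_le hsx hx

theorem rearrangement_antitone (f : α → ℝ≥0∞) : Antitone (rearrangement μ f) := by
  intro t u htu
  exact sInf_le_sInf fun s (hs : _ ≤ _) => hs.trans (ENNReal.ofReal_le_ofReal htu)

theorem measurable_rearrangement (f : α → ℝ≥0∞) : Measurable (rearrangement μ f) :=
  (rearrangement_antitone f).measurable

theorem rearrangement_le_of_measure_le {f : α → ℝ≥0∞} {s : ℝ≥0∞} {t : ℝ}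
    (h : μ {x | s < f x} ≤ ENNReal.ofReal t) : rearrangement μ f t ≤ s :=
  sInf_le h

/-- The distribution function is right-continuous, so the infimum defining the rearrangement
is attained. -/
theorem lt_rearrangement_iff {f : α → ℝ≥0∞} {s : ℝ≥0∞} {t : ℝ} :
    s < rearrangement μ f t ↔ ENNReal.ofReal t < μ {x | s < f x} := by
  constructor
  · intro h
    by_contra! h'
    exact absurd (rearrangement_le_of_measure_le h') (not_le.2 h)
  · intro h
    by_contra! h'
    have hs : s ≠ ∞ := by
      rintro rfl
      simp at h
    obtain ⟨u, hu, hus, hlim⟩ := exists_seq_strictAnti_tendsto' (lt_top_iff_ne_top.2 hs)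
    have hU : {x | s < f x} = ⋃ k, {x | u k < f x} := by
      ext x
      simp only [mem_ofPred_eq, mem_iUnion]
      constructor
      · intro hx
        exact ((hlim.eventually (gt_mem_nhds hx)).exists)
      · rintro ⟨k, hk⟩
        exact (hus k).1.trans hk
    have hmono : Monotone fun k => {x | u k < f x} := by
      intro i j hij x hx
      exact lt_of_le_of_lt (hu.antitone hij) hx
    rw [hU, hmono.measure_iUnion] at h
    obtain ⟨k, hk⟩ := lt_iSup_iff.1 h
    have hlt : rearrangement μ f t < u k := lt_of_le_of_lt h' (hus k).1
    obtain ⟨s', hs', hlt'⟩ := sInf_lt_iff.1 hlt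
    have : μ {x | u k < f x} ≤ ENNReal.ofReal t :=
      (measure_mono fun x hx => lt_trans hlt' hx).trans hs'
    exact absurd hk (not_lt.2 this)

theorem rearrangement_le_iff {f : α → ℝ≥0∞} {s : ℝ≥0∞} {t : ℝ} :
    rearrangement μ f t ≤ s ↔ μ {x | s < f x} ≤ ENNReal.ofReal t := by
  rw [← not_lt, lt_rearrangement_iff, not_lt]

/-- Functions with the same distribution have the same rearrangement. -/
theorem rearrangement_eq_of_measure_eq {f : α → ℝ≥0∞} {g : β → ℝ≥0∞}
    (h : ∀ s, μ {x | s < f x} = ν {x | s < g x}) : rearrangement μ f = rearrangement ν g := by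
  ext1 t
  simp only [rearrangement, h]

theorem rearrangement_comp {σ : α → β} (hσ : MeasurePreserving σ μ ν) {g : β → ℝ≥0∞}
    (hg : AEMeasurable g ν) : rearrangement μ (fun x => g (σ x)) = rearrangement ν g := by
  refine rearrangement_eq_of_measure_eq fun s => ?_
  exact hσ.measure_preimage (nullMeasurableSet_lt aemeasurable_const hg)

instance : SigmaFinite volumeHalfLine := by unfold volumeHalfLine; infer_instance

theorem volumeHalfLine_ofReal_lt (d : ℝ≥0∞) :
    volumeHalfLine {t : ℝ | ENNReal.ofReal t < d} = d := by
  have hm : MeasurableSet {t : ℝ | ENNReal.ofReal t < d} :=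
    measurableSet_lt ENNReal.measurable_ofReal measurable_const
  rw [volumeHalfLine, Measure.restrict_apply hm]
  rcases eq_or_ne d ∞ with rfl | hd
  · simp
  · have : {t : ℝ | ENNReal.ofReal t < d} ∩ Ioi 0 = Ioo 0 d.toReal := by
      ext t
      simp only [mem_inter_iff, mem_ofPred_eq, mem_Ioi, mem_Ioo]
      constructor
      · rintro ⟨h1, h2⟩
        exact ⟨h2, (ENNReal.ofReal_lt_iff_lt_toReal h2.le hd).1 h1⟩
      · rintro ⟨h1, h2⟩
        exact ⟨(ENNReal.ofReal_lt_iff_lt_toReal h1.le hd).2 h2, h1⟩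
    rw [this, Real.volume_Ioo, sub_zero, ENNReal.ofReal_toReal hd]

/-- A function and its rearrangement have the same distribution. -/
theorem volumeHalfLine_lt_rearrangement (f : α → ℝ≥0∞) (s : ℝ≥0∞) :
    volumeHalfLine {t | s < rearrangement μ f t} = μ {x | s < f x} := by
  simp only [lt_rearrangement_iff]
  exact volumeHalfLine_ofReal_lt _

theorem rearrangement_rearrangement (f : α → ℝ≥0∞) :
    rearrangement volumeHalfLine (rearrangement μ f) = rearrangement μ f :=
  rearrangement_eq_of_measure_eq (volumeHalfLine_lt_rearrangement f)

/-- An antitone function on the half-line dominates its rearrangement. -/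
theorem rearrangement_le_of_antitoneOn {g : ℝ → ℝ≥0∞} (hg : AntitoneOn g (Ioi 0)) {t : ℝ}
    (ht : 0 < t) : rearrangement volumeHalfLine g t ≤ g t := by
  refine rearrangement_le_of_measure_le ?_
  calc volumeHalfLine {x | g t < g x} ≤ volumeHalfLine (Iio t ∪ Iic 0) := by
        refine measure_mono fun x hx => ?_
        by_contra! h
        simp only [mem_union, mem_Iio, mem_Iic, not_or, not_lt, not_le] at h
        exact absurd (hg ht h.2 h.1) (not_le.2 hx)
    _ ≤ volumeHalfLine (Iio t) + volumeHalfLine (Iic 0) := measure_union_le _ _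
    _ = ENNReal.ofReal t := by
        rw [volumeHalfLine, Measure.restrict_apply measurableSet_Iio,
          Measure.restrict_apply measurableSet_Iic, Iio_inter_Ioi,
          Iic_inter_Ioi]
        simp

/-- Layer cake formula for `[0, ∞]`-valued functions. -/
theorem lintegral_eq_lintegral_measure_lt [SFinite μ] {f : α → ℝ≥0∞} (hf : AEMeasurable f μ) :
    ∫⁻ x, f x ∂μ = ∫⁻ s, μ {x | ENNReal.ofReal s < f x} ∂volumeHalfLine := by
  wlog h : Measurable f generalizing f
  · rw [lintegral_congr_ae hf.ae_eq_mk, this hf.measurable_mk.aemeasurable hf.measurable_mk]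
    congr 1
    ext s
    refine measure_congr ?_
    filter_upwards [hf.ae_eq_mk] with x hx
    change (_ < _) = (_ < _)
    rw [hx]
  have hS : MeasurableSet {p : α × ℝ | ENNReal.ofReal p.2 < f p.1} :=
    measurableSet_lt (by fun_prop) (by fun_prop)
  calc ∫⁻ x, f x ∂μ
      = ∫⁻ x, volumeHalfLine (Prod.mk x ⁻¹' {p : α × ℝ | ENNReal.ofReal p.2 < f p.1}) ∂μ := by
        refine lintegral_congr fun x => ?_
        exact (volumeHalfLine_ofReal_lt (f x)).symm
    _ = _ := by
        rw [← Measure.prod_apply hS, Measure.prod_apply_symm hS]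
        rfl

theorem lintegral_eq_of_measure_lt_eq [SFinite μ] [SFinite ν] {f : α → ℝ≥0∞} {g : β → ℝ≥0∞}
    (hf : AEMeasurable f μ) (hg : AEMeasurable g ν)
    (h : ∀ s, μ {x | s < f x} = ν {x | s < g x}) : ∫⁻ x, f x ∂μ = ∫⁻ x, g x ∂ν := by
  rw [lintegral_eq_lintegral_measure_lt hf, lintegral_eq_lintegral_measure_lt hg]
  simp only [h]

theorem lintegral_rearrangement [SFinite μ] {f : α → ℝ≥0∞} (hf : AEMeasurable f μ) :
    ∫⁻ t, rearrangement μ f t ∂volumeHalfLine = ∫⁻ x, f x ∂μ :=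
  lintegral_eq_of_measure_lt_eq (measurable_rearrangement f).aemeasurable hf
    (volumeHalfLine_lt_rearrangement f)

theorem lintegral_rearrangement_sub [SFinite μ] {f : α → ℝ≥0∞} (hf : AEMeasurable f μ)
    (s : ℝ≥0∞) :
    ∫⁻ t, (rearrangement μ f t - s) ∂volumeHalfLine = ∫⁻ x, (f x - s) ∂μ := by
  refine lintegral_eq_of_measure_lt_eq ((measurable_rearrangement f).sub_const s).aemeasurable
    (hf.sub_const s) fun u => ?_
  simp only [lt_tsub_iff_right]
  exact volumeHalfLine_lt_rearrangement f _

/-- The rearrangement has the Fatou property. -/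
theorem rearrangement_iSup {f : ℕ → α → ℝ≥0∞} (hf : ∀ᵐ x ∂μ, Monotone fun k => f k x) (t : ℝ) :
    rearrangement μ (fun x => ⨆ k, f k x) t = ⨆ k, rearrangement μ (f k) t := by
  refine le_antisymm ?_ (iSup_le fun k => rearrangement_mono (.of_forall fun x => ?_) t)
  swap
  · exact le_iSup (fun k => f k x) k
  rw [rearrangement_le_iff]
  set s := ⨆ k, rearrangement μ (f k) t
  have hk : ∀ k, μ {x | s < f k x} ≤ ENNReal.ofReal t := fun k =>
    rearrangement_le_iff.1 (le_iSup (fun k => rearrangement μ (f k) t) k)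
  have hmono : Monotone fun k => {x | s < partialSups f k x} := fun i j hij x hx =>
    lt_of_lt_of_le hx ((partialSups f).mono hij x)
  have hps : ∀ k, μ {x | s < partialSups f k x} = μ {x | s < f k x} := by
    intro k
    refine measure_congr ?_
    filter_upwards [hf] with x hx
    change (_ < _) = (_ < _)
    have : partialSups f k x = f k x := by
      rw [Pi.partialSups_apply]
      exact congrFun (hx.partialSups_eq) k
    rw [this]
  calc μ {x | s < ⨆ k, f k x} ≤ μ (⋃ k, {x | s < partialSups f k x}) := by
        refine measure_mono fun x hx => ?_
        obtain ⟨k, hk⟩ := lt_iSup_iff.1 (show s < ⨆ k, f k x from hx)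
        exact mem_iUnion.2 ⟨k, lt_of_lt_of_le hk (le_partialSups f k x)⟩
    _ = ⨆ k, μ {x | s < partialSups f k x} := hmono.measure_iUnion
    _ ≤ ENNReal.ofReal t := iSup_le fun k => (hps k).le.trans (hk k)

end Rearrangement

/-! ### The minimal space: weak `L^p` intersected with `L^∞` as an r.i. space -/

section WeakLpInter

variable {α : Type*} [MeasurableSpace α] {μ : Measure α}

theorem rearrangement_const_mul (a : ℝ≥0) (f : α → ℝ≥0∞) (t : ℝ) :
    rearrangement μ (fun x => a * f x) t = a * rearrangement μ f t := by
  rcases eq_or_ne a 0 with rfl | ha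
  · refine le_antisymm (rearrangement_le_of_measure_le ?_) (by simp)
    simp
  refine eq_of_forall_ge_iff fun s => ?_
  have ha' : (a : ℝ≥0∞) ≠ 0 := by simpa using ha
  rw [rearrangement_le_iff, mul_comm, ← ENNReal.le_div_iff_mul_le (.inl ha') (.inl (by simp)),
    rearrangement_le_iff]
  have : {x | s < a * f x} = {x | s / a < f x} := by
    ext x
    simp only [mem_ofPred_eq]
    rw [ENNReal.div_lt_iff (.inl ha') (.inl (by simp)), mul_comm]
  rw [this]

theorem setLIntegral_Ioo_volumeHalfLine (g : ℝ → ℝ≥0∞) (t : ℝ) :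
    ∫⁻ u in Ioo 0 t, g u ∂volumeHalfLine = ∫⁻ u in Ioo 0 t, g u := by
  rw [volumeHalfLine, Measure.restrict_restrict measurableSet_Ioo,
    inter_eq_self_of_subset_left Ioo_subset_Ioi_self]

/-- The integral of the rearrangement over `(0, t)` is at most `t s + ∫ (f - s)₊` for every
level `s`; there is equality for `s = f^*(t)`, see
`add_lintegral_sub_le_setLIntegral_rearrangement`. -/
theorem setLIntegral_rearrangement_le [SFinite μ] {f : α → ℝ≥0∞} (hf : AEMeasurable f μ)
    (t : ℝ) (s : ℝ≥0∞) :
    ∫⁻ u in Ioo 0 t, rearrangement μ f u ≤ ENNReal.ofReal t * s + ∫⁻ x, (f x - s) ∂μ := by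
  calc ∫⁻ u in Ioo 0 t, rearrangement μ f u
      ≤ ∫⁻ u in Ioo 0 t, (s + (rearrangement μ f u - s)) :=
        lintegral_mono fun u => le_add_tsub
    _ = s * ENNReal.ofReal t + ∫⁻ u in Ioo 0 t, (rearrangement μ f u - s) := by
        rw [lintegral_add_left measurable_const, setLIntegral_const, Real.volume_Ioo, sub_zero]
    _ ≤ _ := by
        rw [mul_comm, ← lintegral_rearrangement_sub hf, ← setLIntegral_Ioo_volumeHalfLine]
        exact add_le_add_right (setLIntegral_le_lintegral _ _) _

/-- The converse of `setLIntegral_rearrangement_le` at the level `f^*(t)`: the function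
`(f^* - f^*(t))₊` vanishes beyond `t`. -/
theorem add_lintegral_sub_le_setLIntegral_rearrangement [SFinite μ] {f : α → ℝ≥0∞}
    (hf : AEMeasurable f μ) (t : ℝ) :
    ENNReal.ofReal t * rearrangement μ f t + ∫⁻ x, (f x - rearrangement μ f t) ∂μ ≤
      ∫⁻ u in Ioo 0 t, rearrangement μ f u := by
  set s := rearrangement μ f t
  have h1 : ∫⁻ x, (f x - s) ∂μ = ∫⁻ u in Ioo 0 t, (rearrangement μ f u - s) := by
    rw [← lintegral_rearrangement_sub hf, volumeHalfLine,
      ← lintegral_indicator measurableSet_Ioi, ← lintegral_indicator measurableSet_Ioo]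
    congr 1
    ext u
    by_cases hu : u ∈ Ioo 0 t
    · rw [indicator_of_mem hu, indicator_of_mem (show u ∈ Ioi 0 from hu.1)]
    · rw [indicator_of_notMem hu]
      by_cases hu0 : u ∈ Ioi (0 : ℝ)
      · rw [indicator_of_mem hu0]
        refine tsub_eq_zero_of_le (rearrangement_antitone f ?_)
        by_contra! h
        exact hu ⟨hu0, h⟩
      · rw [indicator_of_notMem hu0]
  have h2 : ENNReal.ofReal t * s = ∫⁻ u in Ioo 0 t, s := by
    rw [setLIntegral_const, Real.volume_Ioo, sub_zero, mul_comm]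
  rw [h1, h2, ← lintegral_add_left measurable_const]
  refine setLIntegral_mono (measurable_rearrangement f) fun u hu => ?_
  rw [add_tsub_cancel_of_le (rearrangement_antitone f hu.2.le)]

/-- Subadditivity of `f ↦ ∫_0^t f^*`. -/
theorem setLIntegral_rearrangement_add_le [SFinite μ] {f g : α → ℝ≥0∞} (hf : AEMeasurable f μ)
    (hg : AEMeasurable g μ) {t : ℝ} :
    ∫⁻ u in Ioo 0 t, rearrangement μ (fun x => f x + g x) u ≤
      (∫⁻ u in Ioo 0 t, rearrangement μ f u) + ∫⁻ u in Ioo 0 t, rearrangement μ g u := by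
  set a := rearrangement μ f t
  set b := rearrangement μ g t
  calc _ ≤ ENNReal.ofReal t * (a + b) + ∫⁻ x, (f x + g x - (a + b)) ∂μ :=
        setLIntegral_rearrangement_le (hf.add hg) t (a + b)
    _ ≤ ENNReal.ofReal t * (a + b) + ∫⁻ x, ((f x - a) + (g x - b)) ∂μ := by
        gcongr
        exact add_tsub_add_le_tsub_add_tsub
    _ = (ENNReal.ofReal t * a + ∫⁻ x, (f x - a) ∂μ) +
          (ENNReal.ofReal t * b + ∫⁻ x, (g x - b) ∂μ) := by
        rw [lintegral_add_left' (hf.sub_const a), mul_add]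
        ac_rfl
    _ ≤ _ := add_le_add (add_lintegral_sub_le_setLIntegral_rearrangement hf t)
        (add_lintegral_sub_le_setLIntegral_rearrangement hg t)

/-- The Hardy-Littlewood inequality for an indicator function. -/
theorem setLIntegral_le_setLIntegral_rearrangement [SFinite μ] {f : α → ℝ≥0∞}
    (hf : AEMeasurable f μ) {s : Set α} {t : ℝ}
    (hs : μ s ≤ ENNReal.ofReal t) :
    ∫⁻ x in s, f x ∂μ ≤ ∫⁻ u in Ioo 0 t, rearrangement μ f u := by
  set a := rearrangement μ f t
  calc ∫⁻ x in s, f x ∂μ ≤ ∫⁻ x in s, (a + (f x - a)) ∂μ := lintegral_mono fun x => le_add_tsub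
    _ = a * μ s + ∫⁻ x in s, (f x - a) ∂μ := by
        rw [lintegral_add_left measurable_const, setLIntegral_const]
    _ ≤ ENNReal.ofReal t * a + ∫⁻ x, (f x - a) ∂μ := by
        rw [mul_comm]
        exact add_le_add (mul_le_mul' hs le_rfl) (setLIntegral_le_lintegral _ _)
    _ ≤ _ := add_lintegral_sub_le_setLIntegral_rearrangement hf t

/-- The norm `sup_{t > 0} (t⁻¹ + t^{1/p - 1}) ∫_0^t f^*`; for `1 < p` it is equivalent to the
maximum of the quasi-norm of weak `L^p` and the norm of `L^∞`. The average of `f^*` over `(0, t)`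
replaces `f^*(t)` because `f ↦ f^*(t)` is not subadditive. -/
noncomputable def weakLpInterNorm (μ : Measure α) (p : ℝ) (f : α → ℝ≥0∞) : ℝ≥0∞ :=
  ⨆ (t : ℝ) (_ : 0 < t),
    ENNReal.ofReal (t⁻¹ + t ^ (1 / p - 1)) * ∫⁻ u in Ioo 0 t, rearrangement μ f u

theorem weight_mul_le_weakLpInterNorm (p : ℝ) (f : α → ℝ≥0∞) {t : ℝ} (ht : 0 < t) :
    ENNReal.ofReal (t⁻¹ + t ^ (1 / p - 1)) * ∫⁻ u in Ioo 0 t, rearrangement μ f u ≤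
      weakLpInterNorm μ p f :=
  le_iSup₂ (f := fun (t : ℝ) (_ : 0 < t) => ENNReal.ofReal (t⁻¹ + t ^ (1 / p - 1)) *
    ∫⁻ u in Ioo 0 t, rearrangement μ f u) t ht

theorem weakLpInterNorm_mono (p : ℝ) {f g : α → ℝ≥0∞} (h : f ≤ᵐ[μ] g) :
    weakLpInterNorm μ p f ≤ weakLpInterNorm μ p g := by
  refine iSup₂_mono fun t _ => ?_
  gcongr
  exact rearrangement_mono h _

theorem weakLpInterNorm_weight_pos (p : ℝ) {t : ℝ} (ht : 0 < t) :
    0 < ENNReal.ofReal (t⁻¹ + t ^ (1 / p - 1)) :=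
  ENNReal.ofReal_pos.2 (by positivity)

theorem weakLpInterNorm_indicator_lt_top {p : ℝ} (hp : 1 < p) {s : Set α} (hs : MeasurableSet s)
    (hμs : μ s < ∞) [SFinite μ] : weakLpInterNorm μ p (s.indicator fun _ => 1) < ∞ := by
  refine lt_of_le_of_lt (b := 2 + 2 * μ s) (iSup₂_le fun t ht => ?_)
    (ENNReal.add_lt_top.2 ⟨by simp, ENNReal.mul_lt_top (by simp) hμs⟩)
  have hp0 : 0 < 1 / p := by positivity
  have hp1 : 1 / p < 1 := by rw [div_lt_one (by linarith)]; exact hp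
  have hle1 : ∫⁻ u in Ioo 0 t, rearrangement μ (s.indicator fun _ => 1) u ≤ ENNReal.ofReal t := by
    calc _ ≤ ∫⁻ u in Ioo 0 t, 1 := by
          refine lintegral_mono fun u => rearrangement_le_of_measure_le ?_
          have : {x | 1 < s.indicator (fun _ => (1 : ℝ≥0∞)) x} = ∅ := by
            ext x
            by_cases hx : x ∈ s <;> simp [hx]
          simp [this]
      _ = _ := by simp
  have hle2 : ∫⁻ u in Ioo 0 t, rearrangement μ (s.indicator fun _ => 1) u ≤ μ s := by
    calc _ ≤ ∫⁻ u, rearrangement μ (s.indicator fun _ => 1) u ∂volumeHalfLine := by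
          rw [← setLIntegral_Ioo_volumeHalfLine]
          exact setLIntegral_le_lintegral _ _
      _ = _ := by
          rw [lintegral_rearrangement (by fun_prop (disch := assumption)), lintegral_indicator hs]
          simp
  -- the weight is at most `2 / t` for `t ≤ 1` and at most `2` for `t ≥ 1`
  rcases le_total t 1 with h | h
  · calc _ ≤ ENNReal.ofReal (2 * t⁻¹) * ENNReal.ofReal t := by
          gcongr
          have : t ^ (1 / p - 1) ≤ t ^ (-1 : ℝ) :=
            Real.rpow_le_rpow_of_exponent_ge ht h (by linarith)
          rw [Real.rpow_neg_one] at this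
          linarith
      _ = 2 := by
          rw [← ENNReal.ofReal_mul (by positivity), mul_assoc, inv_mul_cancel₀ ht.ne']
          simp
      _ ≤ _ := le_self_add
  · calc _ ≤ ENNReal.ofReal 2 * μ s := by
          gcongr
          have h1 : t ^ (1 / p - 1) ≤ 1 := Real.rpow_le_one_of_one_le_of_nonpos h (by linarith)
          have h2 : t⁻¹ ≤ 1 := inv_le_one_of_one_le₀ h
          linarith
      _ ≤ _ := by
          rw [ENNReal.ofReal_ofNat]
          exact le_add_self

/-- Weak `L^p` intersected with `L^∞`, for `1 < p`, as a rearrangement invariant space. -/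
noncomputable def weakLpInter (μ : Measure α) [SigmaFinite μ] (p : ℝ) (hp : 1 < p) :
    RINorm μ where
  toFun := weakLpInterNorm μ p
  eq_zero_iff f hf := by
    constructor
    · intro h
      -- the averages of `f^*` vanish, hence so does `f^*`, and `f` has the same distribution
      have h0 : ∀ t : ℝ, 0 < t → rearrangement μ f t = 0 := by
        intro t ht
        have h1 := (weight_mul_le_weakLpInterNorm (μ := μ) p f ht).trans h.le
        have h2 : ∫⁻ u in Ioo 0 t, rearrangement μ f u = 0 := by
          by_contra h3
          exact (ENNReal.mul_pos (weakLpInterNorm_weight_pos p ht).ne' h3).not_ge h1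
        have h3 := (add_lintegral_sub_le_setLIntegral_rearrangement hf t).trans h2.le
        have h4 := le_self_add.trans h3
        by_contra h5
        exact (ENNReal.mul_pos (ENNReal.ofReal_pos.2 ht).ne' h5).not_ge h4
      have h1 : μ {x | 0 < f x} = 0 := by
        rw [← volumeHalfLine_lt_rearrangement, volumeHalfLine, ← nonpos_iff_eq_zero]
        refine le_trans (measure_mono (t := Iic 0) fun u hu => ?_) ?_
        · by_contra h'
          exact (ne_of_gt hu) (h0 u (not_le.1 h'))
        · rw [Measure.restrict_apply measurableSet_Iic, Iic_inter_Ioi]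
          simp
      rw [Filter.EventuallyEq, ae_iff]
      simpa [pos_iff_ne_zero] using h1
    · intro h
      rw [← nonpos_iff_eq_zero]
      refine iSup₂_le fun t _ => ?_
      have : ∀ u, rearrangement μ f u = 0 := fun u => by
        rw [← nonpos_iff_eq_zero]
        refine (rearrangement_mono h.le u).trans (rearrangement_le_of_measure_le ?_)
        simp
      simp [this]
  smul a f _ := by
    simp only [weakLpInterNorm, rearrangement_const_mul, ENNReal.mul_iSup]
    refine iSup_congr fun t => iSup_congr fun _ => ?_
    rw [lintegral_const_mul _ (measurable_rearrangement f), mul_left_comm]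
  add_le f g hf hg := by
    refine iSup₂_le fun t ht => ?_
    calc _ ≤ ENNReal.ofReal (t⁻¹ + t ^ (1 / p - 1)) * ((∫⁻ u in Ioo 0 t, rearrangement μ f u) +
          ∫⁻ u in Ioo 0 t, rearrangement μ g u) := by
          gcongr
          exact setLIntegral_rearrangement_add_le hf hg
      _ ≤ _ := by
          rw [mul_add]
          exact add_le_add (weight_mul_le_weakLpInterNorm p f ht)
            (weight_mul_le_weakLpInterNorm p g ht)
  mono f g _ _ h := weakLpInterNorm_mono p h
  fatou f _ hmono := by
    simp only [weakLpInterNorm, rearrangement_iSup hmono]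
    have : ∀ t : ℝ, ∫⁻ u in Ioo 0 t, ⨆ k, rearrangement μ (f k) u =
        ⨆ k, ∫⁻ u in Ioo 0 t, rearrangement μ (f k) u := fun t =>
      lintegral_iSup (fun k => measurable_rearrangement (f k)) fun i j hij u =>
        rearrangement_mono (hmono.mono fun x hx => hx hij) u
    simp only [this, ENNReal.mul_iSup]
    conv_rhs => rw [iSup_comm]
    exact iSup_congr fun t => iSup_comm
  indicator_lt_top s hs hμs := weakLpInterNorm_indicator_lt_top hp hs hμs
  setLIntegral_le s _ hμs := by
    -- adding `1` covers the case `μ s = 0`, as the norm only involves `(0, t)` with `t > 0`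
    have ht : 0 < (μ s).toReal + 1 := by positivity
    set t := (μ s).toReal + 1
    refine ⟨(t⁻¹ + t ^ (1 / p - 1)).toNNReal⁻¹, fun f hf => ?_⟩
    have hst : μ s ≤ ENNReal.ofReal t := by
      rw [← ENNReal.ofReal_toReal hμs.ne]
      exact ENNReal.ofReal_le_ofReal (by simp [t])
    have hw : (t⁻¹ + t ^ (1 / p - 1)).toNNReal ≠ 0 :=
      (Real.toNNReal_pos.2 (by positivity)).ne'
    refine (setLIntegral_le_setLIntegral_rearrangement hf hst).trans ?_
    rw [ENNReal.coe_inv hw, mul_comm, ← div_eq_mul_inv, ENNReal.le_div_iff_mul_le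
      (.inl (by simpa using hw)) (.inl (by simp)), mul_comm]
    exact weight_mul_le_weakLpInterNorm p f ht
  rearrangement_invariant f g _ _ h := by
    simp only [weakLpInterNorm, h]

theorem rearrangement_le_eLpNorm_top (f : α → ℝ) (t : ℝ) :
    rearrangement μ (fun x => ‖f x‖ₑ) t ≤ eLpNorm f ∞ μ := by
  refine rearrangement_le_of_measure_le ?_
  rw [eLpNorm_exponent_top]
  rw [meas_eLpNormEssSup_lt]
  simp

theorem mem_weakLpInter_iff [SigmaFinite μ] {p : ℝ} (hp : 1 < p) (f : α → ℝ) :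
    (weakLpInter μ p hp).Mem f ↔ MemWeakLp f p μ ∧ MemLp f ∞ μ := by
  have hp0 : 0 < 1 / p := by positivity
  have hp1 : 1 / p < 1 := by rw [div_lt_one (by linarith)]; exact hp
  constructor
  · rintro ⟨hf, hfin⟩
    have key : ∀ t : ℝ, 0 < t → ENNReal.ofReal (1 + t ^ (1 / p)) *
        rearrangement μ (fun x => ‖f x‖ₑ) t ≤ weakLpInterNorm μ p (fun x => ‖f x‖ₑ) := by
      intro t ht
      refine le_trans ?_ (weight_mul_le_weakLpInterNorm p _ ht)
      have h1 : 1 + t ^ (1 / p) = (t⁻¹ + t ^ (1 / p - 1)) * t := by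
        rw [add_mul, inv_mul_cancel₀ ht.ne', Real.rpow_sub_one ht.ne', div_mul_cancel₀ _ ht.ne']
      rw [h1, ENNReal.ofReal_mul (by positivity), mul_assoc]
      gcongr
      exact le_self_add.trans (add_lintegral_sub_le_setLIntegral_rearrangement hf.enorm t)
    refine ⟨⟨hf, lt_of_le_of_lt (iSup₂_le fun t ht => ?_) hfin⟩, hf, ?_⟩
    · refine le_trans ?_ (key t ht)
      gcongr
      linarith
    · rw [eLpNorm_exponent_top]
      refine lt_of_le_of_lt (essSup_le_of_ae_le _ ?_) hfin
      change ∀ᵐ x ∂μ, ‖f x‖ₑ ≤ weakLpInterNorm μ p (fun x => ‖f x‖ₑ)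
      rw [ae_iff]
      simp only [not_le]
      refine le_antisymm (ENNReal.le_of_forall_pos_le_add fun ε hε _ => ?_) (by simp)
      rw [zero_add, ← ENNReal.ofReal_coe_nnreal, ← rearrangement_le_iff]
      refine le_trans ?_ (key ε hε)
      refine le_mul_of_one_le_left (by simp) ?_
      rw [ENNReal.one_le_ofReal]
      simp only [le_add_iff_nonneg_right]
      positivity
  · rintro ⟨⟨hf, hw⟩, hb⟩
    refine ⟨hf, ?_⟩
    set A := ⨆ (t : ℝ) (_ : 0 < t),
      ENNReal.ofReal (t ^ (1 / p)) * rearrangement μ (fun x => ‖f x‖ₑ) t with hA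
    have hAt : ∀ t : ℝ, 0 < t →
        rearrangement μ (fun x => ‖f x‖ₑ) t ≤ A * ENNReal.ofReal (t ^ (-(1 / p))) := by
      intro t ht
      rw [Real.rpow_neg ht.le, ENNReal.ofReal_inv_of_pos (by positivity), ← div_eq_mul_inv,
        ENNReal.le_div_iff_mul_le (.inl (ENNReal.ofReal_pos.2 (by positivity)).ne')
          (.inl (by simp)), mul_comm]
      exact le_iSup₂ (f := fun (t : ℝ) (_ : 0 < t) => ENNReal.ofReal (t ^ (1 / p)) *
        rearrangement μ (fun x => ‖f x‖ₑ) t) t ht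
    have hint : ∀ t : ℝ, 0 < t → ∫⁻ u in Ioo 0 t, ENNReal.ofReal (u ^ (-(1 / p))) =
        ENNReal.ofReal (t ^ (1 - 1 / p) / (1 - 1 / p)) := by
      intro t ht
      rw [← ofReal_integral_eq_lintegral_ofReal]
      · rw [← integral_Ioc_eq_integral_Ioo, ← intervalIntegral.integral_of_le ht.le,
          integral_rpow (.inl (by linarith)), Real.zero_rpow (by linarith), sub_zero]
        rw [neg_add_eq_sub]
      · rw [← IntegrableOn, intervalIntegral.integrableOn_Ioo_rpow_iff ht]
        linarith
      · filter_upwards [ae_restrict_mem measurableSet_Ioo] with u hu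
        exact Real.rpow_nonneg hu.1.le _
    refine lt_of_le_of_lt (b := eLpNorm f ∞ μ + A * ENNReal.ofReal (1 / (1 - 1 / p)))
      (iSup₂_le fun t ht => ?_)
      (ENNReal.add_lt_top.2 ⟨hb.2, ENNReal.mul_lt_top hw (by simp)⟩)
    rw [ENNReal.ofReal_add (by positivity) (by positivity), add_mul]
    refine add_le_add ?_ ?_
    · calc _ ≤ ENNReal.ofReal t⁻¹ * ∫⁻ u in Ioo 0 t, eLpNorm f ∞ μ := by
            gcongr
            exact rearrangement_le_eLpNorm_top f _
        _ = eLpNorm f ∞ μ := by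
            rw [setLIntegral_const, Real.volume_Ioo, sub_zero, mul_comm, mul_assoc,
              ← ENNReal.ofReal_mul ht.le, mul_inv_cancel₀ ht.ne']
            simp
    · calc _ ≤ ENNReal.ofReal (t ^ (1 / p - 1)) *
            ∫⁻ u in Ioo 0 t, A * ENNReal.ofReal (u ^ (-(1 / p))) := by
            exact mul_le_mul' le_rfl (setLIntegral_mono' measurableSet_Ioo fun u hu => hAt u hu.1)
        _ = A * ENNReal.ofReal (1 / (1 - 1 / p)) := by
            rw [lintegral_const_mul _ (by fun_prop), hint t ht, mul_left_comm,
              ← ENNReal.ofReal_mul (by positivity), ← mul_div_assoc, ← Real.rpow_add ht]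
            simp

end WeakLpInter

/-! ### Representation on the half-line -/

section Representation

theorem MeasureTheory.MeasurePreserving.aemeasurable_comp {α β : Type*}
    [MeasurableSpace α] [MeasurableSpace β] {μ : Measure α} {ν : Measure β} {σ : α → β}
    (hσ : MeasurePreserving σ μ ν) {g : β → ℝ≥0∞} (hg : AEMeasurable g ν) :
    AEMeasurable (fun x => g (σ x)) μ :=
  hg.comp_quasiMeasurePreserving hσ.quasiMeasurePreserving

theorem lintegral_comp_of_measurePreserving {α β : Type*} [MeasurableSpace α] [MeasurableSpace β]
    {μ : Measure α} {ν : Measure β} {σ : α → β} (hσ : MeasurePreserving σ μ ν) {g : β → ℝ≥0∞}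
    (hg : AEMeasurable g ν) : ∫⁻ x, g (σ x) ∂μ = ∫⁻ y, g y ∂ν := by
  rw [← hσ.map_eq] at hg ⊢
  exact (lintegral_map' hg hσ.measurable.aemeasurable).symm

/-- The r.i. space of all `g` such that `g ∘ σ` belongs to `X`, for a measure preserving `σ`. -/
noncomputable def RINorm.map {α β : Type*} [MeasurableSpace α] [MeasurableSpace β]
    {μ : Measure α} {ν : Measure β} (X : RINorm μ) {σ : α → β} (hσ : MeasurePreserving σ μ ν) :
    RINorm ν where
  toFun g := X.toFun fun x => g (σ x)
  eq_zero_iff f hf := by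
    have hf' := hσ.aemeasurable_comp hf
    rw [X.eq_zero_iff _ hf', ← lintegral_eq_zero_iff' hf', ← lintegral_eq_zero_iff' hf,
      ← lintegral_comp_of_measurePreserving hσ hf]
  smul a f hf := X.smul a _ (hσ.aemeasurable_comp hf)
  add_le f g hf hg := X.add_le _ _ (hσ.aemeasurable_comp hf) (hσ.aemeasurable_comp hg)
  mono f g hf hg h := X.mono _ _ (hσ.aemeasurable_comp hf) (hσ.aemeasurable_comp hg)
    (hσ.quasiMeasurePreserving.ae h)
  fatou f hf h := X.fatou (fun k x => f k (σ x)) (fun k => hσ.aemeasurable_comp (hf k))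
    (hσ.quasiMeasurePreserving.ae h)
  indicator_lt_top s hs hμs :=
    X.indicator_lt_top (σ ⁻¹' s) (hσ.measurable hs)
      (by rwa [hσ.measure_preimage hs.nullMeasurableSet])
  setLIntegral_le s hs hμs := by
    obtain ⟨C, hC⟩ := X.setLIntegral_le (σ ⁻¹' s) (hσ.measurable hs)
      (by rwa [hσ.measure_preimage hs.nullMeasurableSet])
    refine ⟨C, fun f hf => le_trans (le_of_eq ?_) (hC _ (hσ.aemeasurable_comp hf))⟩
    rw [← lintegral_indicator hs, ← lintegral_indicator (hσ.measurable hs),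
      ← lintegral_comp_of_measurePreserving hσ (hf.indicator hs)]
    rfl
  rearrangement_invariant f g hf hg h :=
    X.rearrangement_invariant _ _ (hσ.aemeasurable_comp hf) (hσ.aemeasurable_comp hg)
      (by rw [rearrangement_comp hσ hf, rearrangement_comp hσ hg, h])

variable {α : Type*} [MeasurableSpace α] {μ : Measure α}

/-- Any measure preserving map to the half-line gives a representation: `f` and `f^* ∘ σ` are
equimeasurable. -/
theorem isRepresentation_map (X : RINorm μ) {σ : α → ℝ}
    (hσ : MeasurePreserving σ μ volumeHalfLine) : IsRepresentation X (X.map hσ) := by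
  intro f hf
  have hm := (measurable_rearrangement (μ := μ) f).aemeasurable (μ := volumeHalfLine)
  refine X.rearrangement_invariant _ _ hf (hσ.aemeasurable_comp hm) ?_
  exact ((rearrangement_comp hσ hm).trans (rearrangement_rearrangement f)).symm

/-- Every representation of `X` is given by composition with a measure preserving map. -/
theorem IsRepresentation.toFun_comp {X : RINorm μ} {Xbar : RINorm volumeHalfLine}
    (h : IsRepresentation X Xbar) {σ : α → ℝ} (hσ : MeasurePreserving σ μ volumeHalfLine)
    {g : ℝ → ℝ≥0∞} (hg : AEMeasurable g volumeHalfLine) :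
    X.toFun (fun x => g (σ x)) = Xbar.toFun g := by
  refine (h _ (hσ.aemeasurable_comp hg)).trans ?_
  refine (congrArg Xbar.toFun (rearrangement_comp hσ hg)).trans ?_
  exact Xbar.rearrangement_invariant _ _ (measurable_rearrangement g).aemeasurable hg
    (rearrangement_rearrangement g)

/-- The volume of the ball of radius `‖x‖` in `ℝⁿ`. -/
noncomputable def ballVolume {n : ℕ} (x : EuclideanSpace ℝ (Fin n)) : ℝ :=
  volume.real (Metric.ball (0 : EuclideanSpace ℝ (Fin n)) 1) * ‖x‖ ^ n

theorem volume_unitBall_pos (n : ℕ) :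
    0 < volume.real (Metric.ball (0 : EuclideanSpace ℝ (Fin n)) 1) :=
  ENNReal.toReal_pos (Metric.measure_ball_pos _ _ one_pos).ne' measure_ball_lt_top.ne

theorem volume_ballVolume_le {n : ℕ} (hn : 1 ≤ n) (c : ℝ) :
    volume {x : EuclideanSpace ℝ (Fin n) | ballVolume x ≤ c} = ENNReal.ofReal c := by
  have hω := volume_unitBall_pos n
  set ω := volume.real (Metric.ball (0 : EuclideanSpace ℝ (Fin n)) 1) with hωdef
  have hn0 : n ≠ 0 := by omega
  rcases lt_or_ge c 0 with hc | hc
  · have : {x : EuclideanSpace ℝ (Fin n) | ballVolume x ≤ c} = ∅ := by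
      ext x
      simp only [mem_ofPred_eq, mem_empty_iff_false, iff_false, not_le]
      exact hc.trans_le (by unfold ballVolume; positivity)
    rw [this, measure_empty, ENNReal.ofReal_of_nonpos hc.le]
  · have : {x : EuclideanSpace ℝ (Fin n) | ballVolume x ≤ c} =
        Metric.closedBall 0 ((c / ω) ^ (n⁻¹ : ℝ)) := by
      ext x
      simp only [mem_ofPred_eq, Metric.mem_closedBall, dist_zero_right]
      rw [ballVolume, ← hωdef, ← le_div_iff₀' hω, Real.le_rpow_inv_iff_of_pos (norm_nonneg _)
        (by positivity) (by positivity), Real.rpow_natCast]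
    rw [this, Measure.addHaar_closedBall _ _ (by positivity), finrank_euclideanSpace_fin,
      ← Real.rpow_natCast, Real.rpow_inv_rpow (by positivity) (by positivity),
      ← ofReal_measureReal measure_ball_lt_top.ne, ← hωdef, ← ENNReal.ofReal_mul (by positivity),
      div_mul_cancel₀ _ hω.ne']

theorem measurable_ballVolume {n : ℕ} :
    Measurable (ballVolume : EuclideanSpace ℝ (Fin n) → ℝ) := by
  unfold ballVolume
  fun_prop

theorem measurePreserving_ballVolume {n : ℕ} (hn : 1 ≤ n) :
    MeasurePreserving (ballVolume : EuclideanSpace ℝ (Fin n) → ℝ) volume volumeHalfLine := by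
  refine ⟨measurable_ballVolume, ?_⟩
  have h1 : ∀ c, Measure.map (ballVolume : EuclideanSpace ℝ (Fin n) → ℝ) volume (Iic c) =
      ENNReal.ofReal c := fun c => by
    rw [Measure.map_apply measurable_ballVolume measurableSet_Iic]
    exact volume_ballVolume_le hn c
  have h2 : ∀ c, volumeHalfLine (Iic c) = ENNReal.ofReal c := fun c => by
    rw [volumeHalfLine, Measure.restrict_apply measurableSet_Iic, Iic_inter_Ioi, Real.volume_Ioc,
      sub_zero]
  refine Measure.ext_of_Ioc' _ _ (fun a b _ => ?_) fun a b hab => ?_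
  · exact ((measure_mono Ioc_subset_Iic_self).trans_lt (by rw [h1]; simp)).ne
  · rw [← Iic_sdiff_Iic, measure_sdiff (Iic_subset_Iic.2 hab.le)
      measurableSet_Iic.nullMeasurableSet (by rw [h1]; simp),
      measure_sdiff (Iic_subset_Iic.2 hab.le) measurableSet_Iic.nullMeasurableSet (by rw [h2]; simp),
      h1, h1, h2, h2]

end Representation

/-! ### Functions comparable to the Newtonian kernel at infinity -/

section Comparison

variable {n : ℕ}

/-- Two functions that are comparable outside a ball and bounded inside: finiteness of the norm
passes from one to the other. -/
theorem RINorm.toFun_lt_top_of_le (X : RINorm (volume : Measure (EuclideanSpace ℝ (Fin n))))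
    {f g : EuclideanSpace ℝ (Fin n) → ℝ≥0∞} (hf : AEMeasurable f) (hg : AEMeasurable g)
    (c d : ℝ≥0) (R : ℝ) (h1 : ∀ᵐ x, R ≤ ‖x‖ → f x ≤ c * g x) (h2 : ∀ᵐ x, ‖x‖ < R → f x ≤ d)
    (hX : X.toFun g < ∞) : X.toFun f < ∞ := by
  let s := Metric.ball (0 : EuclideanSpace ℝ (Fin n)) R
  have hs : AEMeasurable (s.indicator fun _ => (1 : ℝ≥0∞)) :=
    (measurable_const.indicator Metric.isOpen_ball.measurableSet).aemeasurable
  calc X.toFun f ≤ X.toFun (fun x => c * g x + d * s.indicator (fun _ => (1 : ℝ≥0∞)) x) := by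
        refine X.mono _ _ hf (by fun_prop) ?_
        filter_upwards [h1, h2] with x hx1 hx2
        rcases lt_or_ge ‖x‖ R with h | h
        · have hx : x ∈ s := by simpa [s] using h
          rw [indicator_of_mem hx, mul_one]
          exact (hx2 h).trans le_add_self
        · exact (hx1 h).trans le_self_add
    _ ≤ c * X.toFun g + d * X.toFun (s.indicator fun _ => 1) := by
        refine (X.add_le _ _ (by fun_prop) (by fun_prop)).trans_eq ?_
        rw [X.smul c g hg, X.smul d _ hs]
    _ < ∞ := ENNReal.add_lt_top.2 ⟨ENNReal.mul_lt_top (by simp) hX,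
        ENNReal.mul_lt_top (by simp)
          (X.indicator_lt_top s Metric.isOpen_ball.measurableSet measure_ball_lt_top)⟩

/-- The regularised power `(ε + ‖x‖²)^{-b}` of the distance to the origin. -/
noncomputable def regPower {E : Type*} [Norm E] (ε b : ℝ) (x : E) : ℝ :=
  (ε + ‖x‖ ^ 2) ^ (-b)

theorem regPower_pos {E : Type*} [SeminormedAddCommGroup E] {ε : ℝ} (hε : 0 < ε) (b : ℝ) (x : E) :
    0 < regPower ε b x := by
  unfold regPower
  positivity

theorem regPower_le_one {E : Type*} [SeminormedAddCommGroup E] {b : ℝ} (hb : 0 ≤ b) (x : E) :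
    regPower 1 b x ≤ 1 :=
  Real.rpow_le_one_of_one_le_of_nonpos (by nlinarith [sq_nonneg ‖x‖]) (by linarith)

theorem norm_sq_rpow (y b : ℝ) (hy : 0 ≤ y) : (y ^ 2) ^ b = y ^ (2 * b) := by
  rw [Real.rpow_mul hy]
  norm_cast

theorem regPower_le_norm_rpow {E : Type*} [SeminormedAddCommGroup E] {ε b : ℝ} (hε : 0 < ε)
    (hb : 0 ≤ b) {x : E} (hx : 0 < ‖x‖) : regPower ε b x ≤ ‖x‖ ^ (-(2 * b)) := by
  rw [show -(2 * b) = 2 * (-b) by ring, ← norm_sq_rpow _ _ hx.le]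
  exact Real.rpow_le_rpow_of_nonpos (by positivity) (by linarith) (by linarith)

theorem norm_rpow_le_regPower {E : Type*} [SeminormedAddCommGroup E] {b : ℝ}
    (hb : 0 ≤ b) {x : E} (hx : 1 ≤ ‖x‖) : ‖x‖ ^ (-(2 * b)) ≤ 2 ^ b * regPower 1 b x := by
  have h0 : 0 < ‖x‖ := by linarith
  have : (2 * ‖x‖ ^ 2) ^ (-b) ≤ regPower 1 b x :=
    Real.rpow_le_rpow_of_nonpos (by positivity) (by nlinarith) (by linarith)
  rw [Real.mul_rpow (by norm_num) (by positivity), norm_sq_rpow _ _ h0.le, Real.rpow_neg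
    (by norm_num), inv_mul_le_iff₀ (by positivity)] at this
  rwa [show -(2 * b) = 2 * (-b) by ring]

theorem continuous_regPower {E : Type*} [SeminormedAddCommGroup E] {ε : ℝ} (hε : 0 < ε) (b : ℝ) :
    Continuous (regPower ε b : E → ℝ) := by
  unfold regPower
  exact Continuous.rpow_const (by fun_prop) fun x => .inl (by positivity)

/-- The function `(1 + ‖x‖²)^{(2 - n)/2}`, a smooth substitute for `min 1 ‖x‖^{2 - n}`, with
values in `[0, ∞]`. -/
noncomputable def newtonProfile (n : ℕ) (x : EuclideanSpace ℝ (Fin n)) : ℝ≥0∞ :=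
  ENNReal.ofReal (regPower 1 (((n : ℝ) - 2) / 2) x)

theorem measurable_newtonProfile : Measurable (newtonProfile n) :=
  (continuous_regPower one_pos _).measurable.ennreal_ofReal

/-- If `X` contains a function that is at least a multiple of `‖x‖^{2-n}` near infinity, then it
contains `newtonProfile n`. -/
theorem toFun_newtonProfile_lt_top (hn : 3 ≤ n)
    (X : RINorm (volume : Measure (EuclideanSpace ℝ (Fin n))))
    {g : EuclideanSpace ℝ (Fin n) → ℝ≥0∞} (hg : AEMeasurable g) {c R : ℝ} (hc : 0 < c)
    (hR : 0 < R)
    (h : ∀ᵐ x : EuclideanSpace ℝ (Fin n), R ≤ ‖x‖ →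
      ENNReal.ofReal (c * ‖x‖ ^ (2 - (n : ℝ))) ≤ g x)
    (hX : X.toFun g < ∞) : X.toFun (newtonProfile n) < ∞ := by
  have hn' : (3 : ℝ) ≤ n := by exact_mod_cast hn
  refine X.toFun_lt_top_of_le measurable_newtonProfile.aemeasurable hg c⁻¹.toNNReal 1 R ?_ ?_ hX
  · filter_upwards [h] with x hx hxR
    calc newtonProfile n x ≤ ENNReal.ofReal (c⁻¹ * (c * ‖x‖ ^ (2 - (n : ℝ)))) := by
          refine ENNReal.ofReal_le_ofReal ?_
          rw [inv_mul_cancel_left₀ hc.ne']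
          convert regPower_le_norm_rpow one_pos (b := ((n : ℝ) - 2) / 2) (by linarith)
            (hR.trans_le hxR) using 2
          ring
      _ ≤ _ := by
          rw [ENNReal.ofReal_mul (by positivity)]
          exact mul_le_mul' le_rfl (hx hxR)
  · refine .of_forall fun x _ => ?_
    exact ENNReal.ofReal_le_one.2 (regPower_le_one (by linarith) x)

/-- If `X` contains `newtonProfile n`, then it contains all locally bounded functions that are at
most a multiple of `‖x‖^{2-n}` near infinity. -/
theorem toFun_lt_top_of_newtonProfile (hn : 3 ≤ n)
    (X : RINorm (volume : Measure (EuclideanSpace ℝ (Fin n))))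
    {g : EuclideanSpace ℝ (Fin n) → ℝ≥0∞} (hg : AEMeasurable g) {c d R : ℝ}
    (hR : 1 ≤ R)
    (h1 : ∀ᵐ x : EuclideanSpace ℝ (Fin n), R ≤ ‖x‖ →
      g x ≤ ENNReal.ofReal (c * ‖x‖ ^ (2 - (n : ℝ))))
    (h2 : ∀ᵐ x : EuclideanSpace ℝ (Fin n), ‖x‖ < R → g x ≤ ENNReal.ofReal d)
    (hX : X.toFun (newtonProfile n) < ∞) : X.toFun g < ∞ := by
  have hn' : (3 : ℝ) ≤ n := by exact_mod_cast hn
  refine X.toFun_lt_top_of_le hg measurable_newtonProfile.aemeasurable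
    (c.toNNReal * (2 ^ (((n : ℝ) - 2) / 2) : ℝ).toNNReal) d.toNNReal R ?_ h2 hX
  filter_upwards [h1] with x hx hxR
  refine (hx hxR).trans ?_
  rw [ENNReal.coe_mul, mul_assoc, ENNReal.ofReal_mul' (by positivity)]
  change _ ≤ ENNReal.ofReal c * (ENNReal.ofReal _ * ENNReal.ofReal _)
  rw [← ENNReal.ofReal_mul (p := 2 ^ _) (by positivity)]
  gcongr
  convert norm_rpow_le_regPower (b := ((n : ℝ) - 2) / 2) (by linarith) (hR.trans hxR) using 2
  ring

end Comparison

/-! ### Monotonicity of ball averages of sub- and superharmonic functions -/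

section BallAverages

variable {n : ℕ}

open scoped RealInnerProductSpace

/-- The function `(1 - ‖y‖²)₊ / 2`. It vanishes outside the unit ball, and its gradient is `-y` in
the unit ball, so that integration by parts against it turns integrals over the ball of
`⟪y, G y⟫` into weighted integrals of the divergence of `G`. -/
noncomputable def paraboloid (y : EuclideanSpace ℝ (Fin n)) : ℝ := (1 - (min ‖y‖ 1) ^ 2) / 2

theorem lipschitzWith_paraboloid :
    LipschitzWith 1 (paraboloid : EuclideanSpace ℝ (Fin n) → ℝ) := by
  refine LipschitzWith.of_dist_le_mul fun x y => ?_
  simp only [paraboloid, NNReal.coe_one, one_mul, Real.dist_eq]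
  have h1 : |min ‖x‖ 1 - min ‖y‖ 1| ≤ dist x y := by
    refine (abs_min_sub_min_le_max _ _ _ _).trans ?_
    rw [sub_self, abs_zero, max_eq_left (abs_nonneg _), dist_eq_norm]
    exact abs_norm_sub_norm_le x y
  have hx0 : 0 ≤ min ‖x‖ 1 := le_min (norm_nonneg _) zero_le_one
  have hy0 : 0 ≤ min ‖y‖ 1 := le_min (norm_nonneg _) zero_le_one
  have hx1 : min ‖x‖ 1 ≤ 1 := min_le_right _ _
  have hy1 : min ‖y‖ 1 ≤ 1 := min_le_right _ _
  have : (1 - (min ‖x‖ 1) ^ 2) / 2 - (1 - (min ‖y‖ 1) ^ 2) / 2 =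
      -((min ‖x‖ 1 - min ‖y‖ 1) * ((min ‖x‖ 1 + min ‖y‖ 1) / 2)) := by ring
  rw [this, abs_neg, abs_mul]
  refine le_trans (mul_le_of_le_one_right (abs_nonneg _) ?_) h1
  rw [abs_of_nonneg (by positivity)]
  linarith

theorem paraboloid_nonneg (y : EuclideanSpace ℝ (Fin n)) : 0 ≤ paraboloid y := by
  have h0 : 0 ≤ min ‖y‖ 1 := le_min (norm_nonneg _) zero_le_one
  have h1 : min ‖y‖ 1 ≤ 1 := min_le_right _ _
  unfold paraboloid
  nlinarith

theorem paraboloid_of_one_le {y : EuclideanSpace ℝ (Fin n)} (hy : 1 ≤ ‖y‖) : paraboloid y = 0 := by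
  simp [paraboloid, min_eq_right hy]

theorem hasCompactSupport_paraboloid :
    HasCompactSupport (paraboloid : EuclideanSpace ℝ (Fin n) → ℝ) := by
  refine HasCompactSupport.intro (isCompact_closedBall 0 1) fun y hy => paraboloid_of_one_le ?_
  simp only [Metric.mem_closedBall, dist_zero_right, not_le] at hy
  exact hy.le

theorem lineDeriv_paraboloid_of_lt {y : EuclideanSpace ℝ (Fin n)} (hy : ‖y‖ < 1)
    (e : EuclideanSpace ℝ (Fin n)) : lineDeriv ℝ paraboloid y e = -⟪y, e⟫ := by
  have h1 : paraboloid =ᶠ[nhds y] fun z : EuclideanSpace ℝ (Fin n) => (1 - ‖z‖ ^ 2) / 2 := by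
    filter_upwards [continuous_norm.continuousAt.eventually (gt_mem_nhds hy)] with z hz
    rw [paraboloid, min_eq_left (le_of_lt hz)]
  have h2 : HasFDerivAt (fun z : EuclideanSpace ℝ (Fin n) => (1 - ‖z‖ ^ 2) / 2)
      (-innerSL ℝ y) y := by
    have := (((hasStrictFDerivAt_norm_sq y).hasFDerivAt.const_sub 1).const_mul (1 / 2))
    refine (this.congr_fderiv ?_).congr_of_eventuallyEq (.of_forall fun z => by simp; ring)
    ext z
    simp
  rw [h1.lineDeriv_eq, h2.hasLineDerivAt e |>.lineDeriv]
  simp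

theorem lineDeriv_paraboloid_of_gt {y : EuclideanSpace ℝ (Fin n)} (hy : 1 < ‖y‖)
    (e : EuclideanSpace ℝ (Fin n)) : lineDeriv ℝ paraboloid y e = 0 := by
  have h1 : paraboloid =ᶠ[nhds y] fun z : EuclideanSpace ℝ (Fin n) => (0 : ℝ) := by
    filter_upwards [continuous_norm.continuousAt.eventually (lt_mem_nhds hy)] with z hz
    exact paraboloid_of_one_le (le_of_lt hz)
  rw [h1.lineDeriv_eq, (hasFDerivAt_const (0 : ℝ) y).hasLineDerivAt e |>.lineDeriv]
  simp

/-- The divergence of a vector field. -/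
noncomputable def divergence (G : EuclideanSpace ℝ (Fin n) → EuclideanSpace ℝ (Fin n))
    (x : EuclideanSpace ℝ (Fin n)) : ℝ :=
  ∑ i, (fderiv ℝ G x (EuclideanSpace.single i 1)) i

theorem continuous_divergence {G : EuclideanSpace ℝ (Fin n) → EuclideanSpace ℝ (Fin n)}
    (hG : ContDiff ℝ 1 G) : Continuous (divergence G) := by
  unfold divergence
  have := hG.continuous_fderiv (by norm_num)
  fun_prop

theorem integrableOn_ball_of_continuous {f : EuclideanSpace ℝ (Fin n) → ℝ} (hf : Continuous f)
    (x : EuclideanSpace ℝ (Fin n)) (r : ℝ) : IntegrableOn f (Metric.ball x r) :=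
  (hf.continuousOn.integrableOn_compact (isCompact_closedBall x r)).mono_set
    Metric.ball_subset_closedBall

/-- Integration by parts on the unit ball. -/
theorem setIntegral_inner_eq_integral_divergence (hn : 1 ≤ n)
    {G : EuclideanSpace ℝ (Fin n) → EuclideanSpace ℝ (Fin n)} (hG : ContDiff ℝ 1 G)
    {C : ℝ≥0} (hC : LipschitzWith C G) :
    ∫ y in Metric.ball 0 1, ⟪y, G y⟫ = ∫ y, divergence G y * paraboloid y := by
  have hcoord : ∀ i : Fin n, LipschitzWith C fun y => G y i := fun i =>
    LipschitzWith.of_dist_le_mul fun x y => by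
      refine le_trans ?_ (hC.dist_le_mul x y)
      rw [dist_eq_norm, dist_eq_norm, ← PiLp.sub_apply]
      exact PiLp.norm_apply_le _ i
  have : Nontrivial (EuclideanSpace ℝ (Fin n)) := by
    refine Module.nontrivial_of_finrank_pos (R := ℝ) ?_
    rw [finrank_euclideanSpace_fin]
    omega
  have key : ∀ i : Fin n, ∫ y in Metric.ball 0 1, y i * G y i =
      ∫ y, (fderiv ℝ G y (EuclideanSpace.single i 1)) i * paraboloid y := by
    intro i
    have h := LipschitzWith.integral_lineDeriv_mul_eq (μ := volume) (hcoord i)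
      lipschitzWith_paraboloid hasCompactSupport_paraboloid (EuclideanSpace.single i (1 : ℝ))
    have h1 : ∀ y, lineDeriv ℝ (fun y => G y i) y (EuclideanSpace.single i (1 : ℝ)) =
        (fderiv ℝ G y (EuclideanSpace.single i 1)) i := by
      intro y
      have h2 := (hG.differentiable (by norm_num) y).hasFDerivAt
      have h3 := ((EuclideanSpace.proj (𝕜 := ℝ) i).hasFDerivAt.comp y h2)
      exact (h3.hasLineDerivAt _).lineDeriv
    simp only [h1] at h
    rw [h, ← integral_indicator Metric.isOpen_ball.measurableSet]
    refine integral_congr_ae ?_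
    have hsph : ∀ᵐ y : EuclideanSpace ℝ (Fin n), y ∉ Metric.sphere 0 1 :=
      measure_eq_zero_iff_ae_notMem.1 (Measure.addHaar_sphere volume 0 1)
    filter_upwards [hsph] with y hy
    rcases lt_trichotomy ‖y‖ 1 with h' | h' | h'
    · rw [indicator_of_mem (by simpa using h'), lineDeriv_paraboloid_of_lt h', inner_neg_right,
        neg_neg, EuclideanSpace.inner_single_right]
      simp
    · exact absurd (by simpa using h') hy
    · rw [indicator_of_notMem (by simpa using h'.le), lineDeriv_paraboloid_of_gt h', zero_mul]
  have hGc := hG.continuous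
  have hdc := hG.continuous_fderiv (by norm_num)
  calc ∫ y in Metric.ball 0 1, ⟪y, G y⟫
      = ∫ y in Metric.ball 0 1, ∑ i, y i * G y i := by
        congr 1
        ext y
        rw [PiLp.inner_apply]
        refine Finset.sum_congr rfl fun i _ => ?_
        simp [mul_comm]
    _ = ∑ i, ∫ y in Metric.ball 0 1, y i * G y i :=
        integral_finsetSum _ fun i _ => integrableOn_ball_of_continuous (by fun_prop) _ _
    _ = ∫ y, ∑ i, (fderiv ℝ G y (EuclideanSpace.single i 1)) i * paraboloid y := by
        rw [integral_finsetSum]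
        · exact Finset.sum_congr rfl fun i _ => key i
        · intro i _
          refine Continuous.integrable_of_hasCompactSupport ?_ ?_
          · have := (lipschitzWith_paraboloid (n := n)).continuous
            fun_prop
          · exact hasCompactSupport_paraboloid.mul_left
    _ = _ := by simp only [divergence, Finset.sum_mul]

theorem hasDerivAt_setIntegral_ball {v : EuclideanSpace ℝ (Fin n) → ℝ}
    {G : EuclideanSpace ℝ (Fin n) → EuclideanSpace ℝ (Fin n)} (hG : Continuous G)
    (hv : ∀ x, HasFDerivAt v (innerSL ℝ (G x)) x) (x : EuclideanSpace ℝ (Fin n)) (r : ℝ) :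
    HasDerivAt (fun r : ℝ => ∫ y in Metric.ball 0 1, v (x - r • y))
      (∫ y in Metric.ball 0 1, ⟪y, -G (x - r • y)⟫) r := by
  have hvc : Continuous v := continuous_iff_continuousAt.2 fun x => (hv x).continuousAt
  have hF' : Continuous fun p : ℝ × EuclideanSpace ℝ (Fin n) => ⟪p.2, -G (x - p.1 • p.2)⟫ := by
    fun_prop
  obtain ⟨B, hB⟩ := ((isCompact_closedBall r 1).prod
    (isCompact_closedBall (0 : EuclideanSpace ℝ (Fin n)) 1)).exists_bound_of_continuousOn
      hF'.continuousOn
  refine (hasDerivAt_integral_of_dominated_loc_of_deriv_le (bound := fun _ => B)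
    (F := fun r y => v (x - r • y))
    (F' := fun r y => ⟪y, -G (x - r • y)⟫) (Metric.closedBall_mem_nhds r one_pos) ?_ ?_ ?_ ?_ ?_
    ?_).2
  · refine .of_forall fun s => Continuous.aestronglyMeasurable (by fun_prop)
  · exact integrableOn_ball_of_continuous (by fun_prop) _ _
  · exact Continuous.aestronglyMeasurable (by fun_prop)
  · filter_upwards [ae_restrict_mem Metric.isOpen_ball.measurableSet] with y hy s hs
    exact hB (s, y) ⟨hs, Metric.ball_subset_closedBall hy⟩
  · exact integrableOn_const measure_ball_lt_top.ne
  · refine .of_forall fun y s _ => ?_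
    have h1 : HasDerivAt (fun s : ℝ => x - s • y) (-y) s := by
      simpa using ((hasDerivAt_id s).smul_const y).const_sub x
    refine ((hv (x - s • y)).comp_hasDerivAt s h1).congr_deriv ?_
    simp [real_inner_comm]

/-- If the Laplacian `div ∇v` is positive on a ball, then `v` is smaller at the centre than its
average: the `r`-derivative of the integral of `v (x - r y)` over the unit ball is `r` times a
weighted integral of the Laplacian. -/
theorem mul_lt_setIntegral_ball_of_divergence_pos (hn : 1 ≤ n) {v : EuclideanSpace ℝ (Fin n) → ℝ}
    {G : EuclideanSpace ℝ (Fin n) → EuclideanSpace ℝ (Fin n)} (hG : ContDiff ℝ 1 G)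
    {C : ℝ≥0} (hC : LipschitzWith C G)
    (hv : ∀ x, HasFDerivAt v (innerSL ℝ (G x)) x) {x : EuclideanSpace ℝ (Fin n)} {R : ℝ}
    (hR : 0 < R) (hdiv : ∀ y ∈ Metric.ball x R, 0 < divergence G y) :
    volume.real (Metric.ball (0 : EuclideanSpace ℝ (Fin n)) R) * v x <
      ∫ y in Metric.ball 0 R, v (x - y) := by
  set φ : ℝ → ℝ := fun r => ∫ y in Metric.ball 0 1, v (x - r • y) with hφ
  have hderiv := hasDerivAt_setIntegral_ball hG.continuous hv x
  have hpos : ∀ r ∈ interior (Icc 0 R), 0 < deriv φ r := by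
    intro r hr
    rw [interior_Icc] at hr
    rw [(hderiv r).deriv]
    set H : EuclideanSpace ℝ (Fin n) → EuclideanSpace ℝ (Fin n) := fun y => -G (x - r • y)
    have hH : ContDiff ℝ 1 H := by fun_prop
    have hHC : LipschitzWith (C * r.toNNReal) H := by
      refine LipschitzWith.of_dist_le_mul fun y z => ?_
      simp only [H, dist_neg_neg]
      refine (hC.dist_le_mul _ _).trans_eq ?_
      rw [dist_sub_left, dist_smul₀, NNReal.coe_mul, mul_assoc, Real.norm_of_nonneg hr.1.le,
        Real.coe_toNNReal _ hr.1.le]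
    have hdH : ∀ y, divergence H y = r * divergence G (x - r • y) := by
      intro y
      have h1 : HasFDerivAt (fun y : EuclideanSpace ℝ (Fin n) => x - r • y)
          (-(r • ContinuousLinearMap.id ℝ (EuclideanSpace ℝ (Fin n)))) y :=
        ((hasFDerivAt_id y).const_smul r).const_sub x
      have h2 : HasFDerivAt H _ y :=
        ((hG.differentiable (by norm_num) (x - r • y)).hasFDerivAt.comp y h1).neg
      simp only [divergence, h2.fderiv, Finset.mul_sum]
      simp
    rw [setIntegral_inner_eq_integral_divergence hn hH hHC]
    refine Continuous.integral_pos_of_hasCompactSupport_nonneg_nonzero (x := 0) ?_ ?_ ?_ ?_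
    · exact (continuous_divergence hH).mul lipschitzWith_paraboloid.continuous
    · exact hasCompactSupport_paraboloid.mul_left
    · intro y
      rcases le_or_gt 1 ‖y‖ with hy | hy
      · simp [paraboloid_of_one_le hy]
      · refine mul_nonneg ?_ (paraboloid_nonneg y)
        rw [hdH]
        refine mul_nonneg hr.1.le (hdiv _ ?_).le
        rw [Metric.mem_ball, dist_eq_norm, sub_sub_cancel_left, norm_neg, norm_smul,
          Real.norm_of_nonneg hr.1.le]
        nlinarith [norm_nonneg y, hr.1, hr.2]
    · rw [hdH, smul_zero, sub_zero]
      have h3 := hdiv x (Metric.mem_ball_self hR)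
      have h4 := hr.1
      have : (0 : ℝ) < paraboloid (0 : EuclideanSpace ℝ (Fin n)) := by simp [paraboloid]
      positivity
  have hmono : StrictMonoOn φ (Icc 0 R) :=
    strictMonoOn_of_deriv_pos (convex_Icc 0 R)
      (fun r _ => (hderiv r).continuousAt.continuousWithinAt) hpos
  have hlt := hmono (left_mem_Icc.2 hR.le) (right_mem_Icc.2 hR.le) hR
  have h0 : φ 0 = volume.real (Metric.ball (0 : EuclideanSpace ℝ (Fin n)) 1) * v x := by
    simp [hφ]
  have h1 : φ R = (R ^ n)⁻¹ * ∫ y in Metric.ball 0 R, v (x - y) := by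
    have := Measure.setIntegral_comp_smul_of_pos volume (fun y => v (x - y))
      (Metric.ball (0 : EuclideanSpace ℝ (Fin n)) 1) hR
    rw [hφ]
    simp only
    rw [this, finrank_euclideanSpace_fin, smul_eq_mul, smul_unitBall_of_pos hR]
  rw [h0, h1, lt_inv_mul_iff₀ (by positivity)] at hlt
  refine lt_of_eq_of_lt ?_ hlt
  rw [measureReal_def, Measure.addHaar_ball_of_pos _ _ hR, finrank_euclideanSpace_fin,
    ENNReal.toReal_mul, ENNReal.toReal_ofReal (by positivity), measureReal_def, mul_assoc]

end BallAverages

/-! ### The Laplacian of the regularised powers -/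

section RegPower

variable {n : ℕ}

open scoped RealInnerProductSpace

theorem hasFDerivAt_regPower {E : Type*} [NormedAddCommGroup E] [InnerProductSpace ℝ E] {ε : ℝ}
    (hε : 0 < ε) (b : ℝ) (x : E) :
    HasFDerivAt (regPower ε b) (innerSL ℝ ((-(2 * b) * regPower ε (b + 1) x) • x)) x := by
  have h1 : HasFDerivAt (fun x : E => ε + ‖x‖ ^ 2) (2 • innerSL ℝ x) x :=
    (hasStrictFDerivAt_norm_sq x).hasFDerivAt.const_add ε
  have h2 := h1.rpow_const (p := -b) (.inl (by positivity))
  refine h2.congr_fderiv ?_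
  ext z
  simp only [regPower, neg_add, ← sub_eq_add_neg, map_smul, smul_apply,
    innerSL_apply_apply, smul_eq_mul, nsmul_eq_mul, Nat.cast_ofNat]
  ring

/-- The gradient of `regPower ε b`. -/
noncomputable def regPowerGrad {E : Type*} [NormedAddCommGroup E] [InnerProductSpace ℝ E]
    (ε b : ℝ) (x : E) : E :=
  (-(2 * b) * regPower ε (b + 1) x) • x

theorem hasFDerivAt_regPowerGrad {E : Type*} [NormedAddCommGroup E] [InnerProductSpace ℝ E]
    {ε : ℝ} (hε : 0 < ε) (b : ℝ) (x : E) :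
    HasFDerivAt (regPowerGrad ε b)
      ((-(2 * b) * regPower ε (b + 1) x) • ContinuousLinearMap.id ℝ E +
        (-(2 * b) * (-(2 * (b + 2 - 1)) * regPower ε (b + 2) x)) •
          (innerSL ℝ x).smulRight x) x := by
  have h1 := ((hasFDerivAt_regPower hε (b + 1) x).const_mul (-(2 * b))).smul (hasFDerivAt_id x)
  refine h1.congr_fderiv ?_
  ext z
  simp only [add_apply, smul_apply,
    ContinuousLinearMap.smulRight_apply, innerSL_apply_apply, ContinuousLinearMap.id_apply, id,
    inner_smul_left, smul_eq_mul, smul_smul]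
  congr 2
  rw [show b + 1 + 1 = b + 2 by ring]
  simp
  ring

theorem contDiff_regPower {E : Type*} [NormedAddCommGroup E] [InnerProductSpace ℝ E]
    {ε : ℝ} (hε : 0 < ε) (b : ℝ) : ContDiff ℝ 1 (regPower ε b : E → ℝ) := by
  unfold regPower
  exact ContDiff.rpow_const_of_ne (contDiff_const.add (contDiff_norm_sq ℝ)) fun x => by positivity

theorem contDiff_regPowerGrad {E : Type*} [NormedAddCommGroup E] [InnerProductSpace ℝ E]
    {ε : ℝ} (hε : 0 < ε) (b : ℝ) : ContDiff ℝ 1 (regPowerGrad ε b : E → E) := by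
  have := contDiff_regPower (E := E) hε (b + 1)
  unfold regPowerGrad
  fun_prop

theorem regPower_add_one_mul {E : Type*} [SeminormedAddCommGroup E] {ε : ℝ} (hε : 0 < ε) (b : ℝ)
    (x : E) : regPower ε (b + 1) x * (ε + ‖x‖ ^ 2) = regPower ε b x := by
  have h : 0 < ε + ‖x‖ ^ 2 := by positivity
  rw [regPower, regPower, neg_add, ← sub_eq_add_neg, Real.rpow_sub_one h.ne',
    div_mul_cancel₀ _ h.ne']

theorem exists_lipschitzWith_regPowerGrad {E : Type*} [NormedAddCommGroup E]
    [InnerProductSpace ℝ E] {ε : ℝ} (hε : 0 < ε) {b : ℝ} (hb : 0 ≤ b) :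
    ∃ C, LipschitzWith C (regPowerGrad ε b : E → E) := by
  refine ⟨((2 * b + 2 * b * (2 * (b + 1))) * ε ^ (-(b + 1))).toNNReal,
    lipschitzWith_of_nnnorm_fderiv_le
      (fun x => (hasFDerivAt_regPowerGrad hε b x).differentiableAt) fun x => ?_⟩
  rw [(hasFDerivAt_regPowerGrad hε b x).fderiv, ← NNReal.coe_le_coe, coe_nnnorm,
    Real.coe_toNNReal _ (by positivity)]
  have h1 := regPower_pos hε (b + 1) x
  have h2 := regPower_pos hε (b + 2) x
  have h3 : regPower ε (b + 1) x ≤ ε ^ (-(b + 1)) :=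
    Real.rpow_le_rpow_of_nonpos hε (by nlinarith [sq_nonneg ‖x‖]) (by linarith)
  have h4 : regPower ε (b + 2) x * ‖x‖ ^ 2 ≤ regPower ε (b + 1) x := by
    rw [← regPower_add_one_mul hε (b + 1) x, show b + 1 + 1 = b + 2 by ring]
    gcongr
    linarith
  refine ContinuousLinearMap.opNorm_le_bound _ (by positivity) fun z => ?_
  simp only [add_apply, smul_apply,
    ContinuousLinearMap.smulRight_apply, innerSL_apply_apply, ContinuousLinearMap.id_apply]
  refine (norm_add_le _ _).trans ?_
  rw [norm_smul, norm_smul, norm_smul]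
  have h5 : ‖⟪x, z⟫‖ ≤ ‖x‖ * ‖z‖ := norm_inner_le_norm x z
  have h6 : ‖-(2 * b) * regPower ε (b + 1) x‖ = 2 * b * regPower ε (b + 1) x := by
    rw [neg_mul, norm_neg, Real.norm_of_nonneg (by positivity)]
  have h7 : ‖-(2 * b) * (-(2 * (b + 2 - 1)) * regPower ε (b + 2) x)‖ =
      2 * b * (2 * (b + 1)) * regPower ε (b + 2) x := by
    rw [Real.norm_of_nonneg]
    · ring
    · rw [show b + 2 - 1 = b + 1 by ring]
      have : 0 ≤ 2 * b * (2 * (b + 1)) * regPower ε (b + 2) x := by positivity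
      linarith
  rw [h6, h7]
  calc _ ≤ 2 * b * regPower ε (b + 1) x * ‖z‖ +
        2 * b * (2 * (b + 1)) * regPower ε (b + 2) x * (‖x‖ * ‖z‖ * ‖x‖) := by gcongr
    _ = (2 * b * regPower ε (b + 1) x +
        2 * b * (2 * (b + 1)) * (regPower ε (b + 2) x * ‖x‖ ^ 2)) * ‖z‖ := by ring
    _ ≤ (2 * b * ε ^ (-(b + 1)) + 2 * b * (2 * (b + 1)) * ε ^ (-(b + 1))) * ‖z‖ := by
        gcongr
        exact h4.trans h3
    _ = _ := by ring

/-- The Laplacian of `(ε + ‖x‖²)^{-b}`. -/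
theorem divergence_regPowerGrad {ε : ℝ} (hε : 0 < ε) (b : ℝ) (x : EuclideanSpace ℝ (Fin n)) :
    divergence (regPowerGrad ε b) x =
      2 * b * regPower ε (b + 2) x * ((2 * b + 2 - n) * ‖x‖ ^ 2 - n * ε) := by
  simp only [divergence, (hasFDerivAt_regPowerGrad hε b x).fderiv]
  have h : ∑ i, (((-(2 * b) * regPower ε (b + 1) x) •
      ContinuousLinearMap.id ℝ (EuclideanSpace ℝ (Fin n)) +
        (-(2 * b) * (-(2 * (b + 2 - 1)) * regPower ε (b + 2) x)) •
          (innerSL ℝ x).smulRight x) (EuclideanSpace.single i 1)) i =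
      n * (-(2 * b) * regPower ε (b + 1) x) +
        (-(2 * b) * (-(2 * (b + 2 - 1)) * regPower ε (b + 2) x)) * ‖x‖ ^ 2 := by
    rw [EuclideanSpace.real_norm_sq_eq, Finset.mul_sum]
    simp only [add_apply, smul_apply,
      ContinuousLinearMap.smulRight_apply, innerSL_apply_apply, ContinuousLinearMap.id_apply,
      PiLp.add_apply, PiLp.smul_apply, EuclideanSpace.inner_single_right, Finset.sum_add_distrib]
    simp
    simp only [pow_two]
  rw [h, ← regPower_add_one_mul hε (b + 1) x, show b + 1 + 1 = b + 2 by ring]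
  ring

end RegPower

/-! ### Fixed points of the maximal operator and the minimum principle -/

section FixedPoints

variable {n : ℕ}

theorem volume_ball_ne_zero {r : ℝ} (hr : 0 < r) :
    volume (Metric.ball (0 : EuclideanSpace ℝ (Fin n)) r) ≠ 0 :=
  (Metric.measure_ball_pos _ _ hr).ne'

theorem average_le_iff {r : ℝ} (hr : 0 < r) {a b : ℝ≥0∞} :
    (volume (Metric.ball (0 : EuclideanSpace ℝ (Fin n)) r))⁻¹ * a ≤ b ↔
      a ≤ volume (Metric.ball (0 : EuclideanSpace ℝ (Fin n)) r) * b := by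
  rw [mul_comm, ← div_eq_mul_inv, ENNReal.div_le_iff_le_mul (.inl (volume_ball_ne_zero hr))
    (.inl measure_ball_lt_top.ne), mul_comm]

theorem centeredMaximal_le_iff {f : EuclideanSpace ℝ (Fin n) → ℝ} {x : EuclideanSpace ℝ (Fin n)}
    {a : ℝ≥0∞} : centeredMaximal f x ≤ a ↔ ∀ r : ℝ, 0 < r →
      ∫⁻ y in Metric.ball (0 : EuclideanSpace ℝ (Fin n)) r, ‖f (x - y)‖ₑ ≤
        volume (Metric.ball (0 : EuclideanSpace ℝ (Fin n)) r) * a := by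
  rw [centeredMaximal, iSup₂_le_iff]
  exact forall₂_congr fun r hr => average_le_iff hr

theorem le_centeredMaximal_of_continuous {f : EuclideanSpace ℝ (Fin n) → ℝ} (hf : Continuous f)
    (x : EuclideanSpace ℝ (Fin n)) : ‖f x‖ₑ ≤ centeredMaximal f x := by
  refine le_of_forall_lt fun c hc => ?_
  obtain ⟨c', hcc', hc'⟩ := exists_between hc
  refine hcc'.trans_le ?_
  have hcont : Continuous fun y => ‖f (x - y)‖ₑ := by fun_prop
  have h0 : ∀ᶠ y in nhds 0, c' < ‖f (x - y)‖ₑ :=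
    hcont.continuousAt.eventually (lt_mem_nhds (by simpa using hc'))
  obtain ⟨r, hr, hball⟩ := Metric.eventually_nhds_iff_ball.1 h0
  refine le_trans ?_ (le_iSup₂ (f := fun (r : ℝ) (_ : 0 < r) =>
    (volume (Metric.ball (0 : EuclideanSpace ℝ (Fin n)) r))⁻¹ *
      ∫⁻ y in Metric.ball (0 : EuclideanSpace ℝ (Fin n)) r, ‖f (x - y)‖ₑ) r hr)
  calc c' = (volume (Metric.ball (0 : EuclideanSpace ℝ (Fin n)) r))⁻¹ *
        ∫⁻ y in Metric.ball (0 : EuclideanSpace ℝ (Fin n)) r, c' := by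
        rw [setLIntegral_const, mul_left_comm, ENNReal.inv_mul_cancel (volume_ball_ne_zero hr)
          measure_ball_lt_top.ne, mul_one]
    _ ≤ _ := by
        gcongr 1
        exact setLIntegral_mono' Metric.isOpen_ball.measurableSet fun y hy => (hball y hy).le

/-- The function `(1 + ‖x‖²)^{(2 - n)/2}` is superharmonic, so it dominates its ball averages,
and by continuity it is their supremum. -/
theorem isNonconstantFixedPoint_regPower (hn : 3 ≤ n) :
    IsNonconstantFixedPoint
      (regPower 1 (((n : ℝ) - 2) / 2) : EuclideanSpace ℝ (Fin n) → ℝ) := by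
  have hn' : (3 : ℝ) ≤ n := by exact_mod_cast hn
  set b : ℝ := ((n : ℝ) - 2) / 2 with hb
  have hb0 : 0 < b := by rw [hb]; linarith
  set f : EuclideanSpace ℝ (Fin n) → ℝ := regPower 1 b with hf
  have hfc : Continuous f := continuous_regPower one_pos b
  have hfpos : ∀ x, 0 < f x := regPower_pos one_pos b
  have hen : ∀ x, ‖f x‖ₑ = ENNReal.ofReal (f x) := fun x => Real.enorm_of_nonneg (hfpos x).le
  refine ⟨hfc.locallyIntegrable, .of_forall fun x => ?_, ?_⟩
  · have heq : centeredMaximal f x = ENNReal.ofReal (f x) := by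
      refine le_antisymm (centeredMaximal_le_iff.2 fun r hr => ?_)
        ((hen x).symm.le.trans (le_centeredMaximal_of_continuous hfc x))
      obtain ⟨C, hC⟩ := exists_lipschitzWith_regPowerGrad (E := EuclideanSpace ℝ (Fin n))
        one_pos hb0.le
      have hlt := mul_lt_setIntegral_ball_of_divergence_pos (by omega) (v := fun x => -f x)
        (G := fun x => -regPowerGrad 1 b x) (contDiff_regPowerGrad one_pos b).neg hC.neg
        (fun x => (hasFDerivAt_regPower one_pos b x).neg.congr_fderiv (map_neg (innerSL ℝ) _).symm)
        (x := x) hr (fun y _ => by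
          have h1 : divergence (fun x => -regPowerGrad 1 b x) y =
              -divergence (regPowerGrad 1 b) y := by
            simp only [divergence, fderiv_fun_neg, ← Finset.sum_neg_distrib]
            rfl
          have h2 : 2 * b + 2 - n = 0 := by rw [hb]; ring
          rw [h1, divergence_regPowerGrad one_pos, h2]
          have := regPower_pos one_pos (b + 2) y
          have h3 : 0 < 2 * b * regPower 1 (b + 2) y * n := by positivity
          linarith)
      simp only [hen]
      rw [integral_neg, mul_neg, neg_lt_neg_iff] at hlt
      rw [← ofReal_integral_eq_lintegral_ofReal
        (integrableOn_ball_of_continuous (by fun_prop) _ _) (.of_forall fun y => (hfpos _).le),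
        ← ofReal_measureReal measure_ball_lt_top.ne, ← ENNReal.ofReal_mul (by positivity)]
      exact ENNReal.ofReal_le_ofReal hlt.le
    rw [heq, EReal.coe_ennreal_ofReal, max_eq_left (hfpos x).le]
  · rintro ⟨c, hc⟩
    have h1 : f = fun _ => c := (hfc.ae_eq_iff_eq volume continuous_const).1 hc
    have h2 : f 0 = f (EuclideanSpace.single (⟨0, by omega⟩ : Fin n) 1) := by rw [h1]
    have h3 : (2 : ℝ) ^ (-b) < 1 :=
      Real.rpow_lt_one_of_one_lt_of_neg (by norm_num) (by linarith)
    simp only [hf, regPower] at h2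
    norm_num at h2
    rw [← h2] at h3
    exact lt_irrefl _ h3

/-- A lower semicontinuous function on `ℝⁿ` with values in `[0, ∞]` that dominates all its ball
averages. -/
structure SuperMean (U : EuclideanSpace ℝ (Fin n) → ℝ≥0∞) : Prop where
  /-- lower semicontinuity -/
  lowerSemicontinuous : LowerSemicontinuous U
  /-- the mean value inequality, multiplied by the volume of the ball -/
  setLIntegral_le : ∀ x, ∀ r : ℝ, 0 < r →
    ∫⁻ y in Metric.ball 0 r, U (x - y) ≤
      volume (Metric.ball (0 : EuclideanSpace ℝ (Fin n)) r) * U x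

theorem setLIntegral_ball_sub (F : EuclideanSpace ℝ (Fin n) → ℝ≥0∞)
    (x : EuclideanSpace ℝ (Fin n)) (r : ℝ) :
    ∫⁻ y in Metric.ball 0 r, F (x - y) = ∫⁻ y in Metric.ball x r, F y := by
  rw [← (Measure.measurePreserving_sub_left volume x).setLIntegral_comp_preimage_emb
    (MeasurableEquiv.subLeft x).measurableEmbedding]
  congr 2
  · ext y
    simp [dist_eq_norm, norm_sub_rev]
  · simp

/-- The balls are open, so smaller balls around `x` lie in the balls of radius `r` around nearby
points. No integrability of `F` is needed. -/
theorem lowerSemicontinuous_setLIntegral_ball (F : EuclideanSpace ℝ (Fin n) → ℝ≥0∞) (r : ℝ) :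
    LowerSemicontinuous fun x => ∫⁻ y in Metric.ball 0 r, F (x - y) := by
  simp only [setLIntegral_ball_sub]
  intro x c hc
  have hU : Metric.ball x r = ⋃ k : ℕ, Metric.ball x (r - 1 / ((k : ℝ) + 1)) := by
    ext y
    simp only [mem_iUnion, Metric.mem_ball]
    constructor
    · intro hy
      obtain ⟨k, hk⟩ := exists_nat_one_div_lt (sub_pos.2 hy)
      exact ⟨k, by linarith⟩
    · rintro ⟨k, hk⟩
      have : (0 : ℝ) < 1 / ((k : ℝ) + 1) := by positivity
      linarith
  have hmono : Monotone fun k : ℕ => Metric.ball x (r - 1 / ((k : ℝ) + 1)) := by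
    intro i j hij
    refine Metric.ball_subset_ball ?_
    gcongr
  have hc' : c < ∫⁻ y in Metric.ball x r, F y := hc
  rw [hU, setLIntegral_iUnion_of_directed _ hmono.directed_le] at hc'
  obtain ⟨k, hk⟩ := lt_iSup_iff.1 hc'
  filter_upwards [Metric.ball_mem_nhds x (show (0 : ℝ) < 1 / ((k : ℝ) + 1) by positivity)]
    with x' hx'
  refine hk.trans_le (lintegral_mono_set (Metric.ball_subset_ball' ?_))
  linarith [Metric.mem_ball'.1 hx']

/-- The maximal function of a fixed point is the representative of the fixed point for which the
mean value inequality holds everywhere. -/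
theorem IsNonconstantFixedPoint.superMean {f : EuclideanSpace ℝ (Fin n) → ℝ}
    (hf : IsNonconstantFixedPoint f) :
    SuperMean (centeredMaximal f) ∧
      ∀ᵐ x, ENNReal.ofReal (f x) = centeredMaximal f x ∧ 0 ≤ f x := by
  have hae : ∀ᵐ x, ENNReal.ofReal (f x) = centeredMaximal f x ∧ 0 ≤ f x := by
    filter_upwards [hf.2.1] with x hx
    have h0 : 0 ≤ f x := by
      rw [← EReal.coe_nonneg, ← hx]
      exact EReal.coe_ennreal_nonneg _
    refine ⟨EReal.coe_ennreal_injective ?_, h0⟩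
    rw [hx, EReal.coe_ennreal_ofReal, max_eq_left h0]
  refine ⟨⟨?_, fun x r hr => ?_⟩, hae⟩
  · refine lowerSemicontinuous_biSup fun r hr => ?_
    exact (ENNReal.continuous_const_mul
      (ENNReal.inv_ne_top.2 (volume_ball_ne_zero hr))).comp_lowerSemicontinuous
        (lowerSemicontinuous_setLIntegral_ball (fun y => ‖f y‖ₑ) r)
        fun a b hab => mul_le_mul' le_rfl hab
  · refine le_trans (le_of_eq ?_) (centeredMaximal_le_iff.1 le_rfl r hr)
    rw [setLIntegral_ball_sub, setLIntegral_ball_sub (fun y => ‖f y‖ₑ)]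
    refine lintegral_congr_ae (ae_restrict_of_ae ?_)
    filter_upwards [hae] with y hy
    rw [← hy.1, Real.enorm_of_nonneg hy.2]

/-- Minimum principle with the strictly subharmonic barrier `(ε + ‖x‖²)^{-b}`: where `U` lies below
the barrier, the difference would have a minimum in the interior of an annulus. -/
theorem SuperMean.barrier_le (hn : 1 ≤ n) {U : EuclideanSpace ℝ (Fin n) → ℝ≥0∞} (hU : SuperMean U)
    {m δ ε b : ℝ} (hm : 0 < m) (hδ : 0 < δ) (hε : 0 < ε) (hb : 0 < b)
    (hbε : n * ε < (2 * b + 2 - n) * δ ^ 2)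
    (hUδ : ∀ x, ‖x‖ = δ → ENNReal.ofReal m ≤ U x) (x : EuclideanSpace ℝ (Fin n)) (hx : δ ≤ ‖x‖) :
    ENNReal.ofReal (m * (ε + δ ^ 2) ^ b * (ε + ‖x‖ ^ 2) ^ (-b)) ≤ U x := by
  set K : ℝ := m * (ε + δ ^ 2) ^ b with hK
  have hK0 : 0 < K := by positivity
  set V : EuclideanSpace ℝ (Fin n) → ℝ := fun x => K * regPower ε b x with hV
  have hVc : Continuous V := (continuous_regPower hε b).const_mul K
  -- an upper bound of the barrier, so that `U - V` can be replaced by the `[0, ∞]`-valued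
  -- function `U + (M - V)`
  set M : ℝ := K * ε ^ (-b) + 1 with hM
  have hVM : ∀ x, V x < M := by
    intro x
    have : regPower ε b x ≤ ε ^ (-b) :=
      Real.rpow_le_rpow_of_nonpos hε (by nlinarith [sq_nonneg ‖x‖]) (by linarith)
    have := mul_le_mul_of_nonneg_left this hK0.le
    simp only [hV, hM]
    linarith
  by_contra! hlt
  change U x < ENNReal.ofReal (V x) at hlt
  have hUx : U x ≠ ∞ := (hlt.trans_le le_top).ne
  set η : ℝ := V x - (U x).toReal with hη
  have hη0 : 0 < η := by
    rw [hη, sub_pos]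
    exact (ENNReal.lt_ofReal_iff_toReal_lt hUx).1 hlt
  set W : EuclideanSpace ℝ (Fin n) → ℝ≥0∞ := fun x => U x + ENNReal.ofReal (M - V x) with hW
  have hWc : LowerSemicontinuous W :=
    hU.lowerSemicontinuous.add
      (ENNReal.continuous_ofReal.comp (continuous_const.sub hVc)).lowerSemicontinuous
  have hWx : W x = ENNReal.ofReal (M - η) := by
    simp only [hW]
    rw [← ENNReal.ofReal_toReal hUx, ← ENNReal.ofReal_add ENNReal.toReal_nonneg
      (sub_nonneg.2 (hVM x).le), hη]
    congr 1
    ring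
  -- the barrier is small on a large sphere
  obtain ⟨R, hxR, hR⟩ : ∃ R : ℝ, ‖x‖ < R ∧ K * (ε + R ^ 2) ^ (-b) < η := by
    have h1 : Filter.Tendsto (fun R : ℝ => K * (ε + R ^ 2) ^ (-b)) Filter.atTop (nhds (K * 0)) :=
      ((tendsto_rpow_neg_atTop hb).comp (Filter.tendsto_atTop_add_const_left _ ε
        (Filter.tendsto_pow_atTop two_ne_zero))).const_mul K
    rw [mul_zero] at h1
    exact ((Filter.eventually_gt_atTop ‖x‖).and (h1.eventually (gt_mem_nhds hη0))).exists
  set A : Set (EuclideanSpace ℝ (Fin n)) := Metric.closedBall 0 R ∩ {y | δ ≤ ‖y‖} with hA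
  have hAc : IsCompact A :=
    (isCompact_closedBall 0 R).inter_right (isClosed_le continuous_const continuous_norm)
  have hxA : x ∈ A := ⟨by simpa using hxR.le, hx⟩
  obtain ⟨x₀, hx₀A, hmin⟩ := (hWc.lowerSemicontinuousOn A).exists_isMinOn ⟨x, hxA⟩ hAc
  have hWx₀ : W x₀ ≤ ENNReal.ofReal (M - η) := hWx ▸ hmin hxA
  have hUx₀ : U x₀ ≠ ∞ := (lt_of_le_of_lt (le_self_add.trans hWx₀) ENNReal.ofReal_lt_top).ne
  have hMη : 0 < M - η := by
    have := hVM x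
    have := ENNReal.toReal_nonneg (a := U x)
    linarith
  have hx₀δ : δ < ‖x₀‖ := by
    refine lt_of_le_of_ne hx₀A.2 fun h => ?_
    have hVm : V x₀ = m := by
      simp only [hV, hK, regPower]
      rw [← h, mul_assoc, ← Real.rpow_add (by positivity)]
      simp
    have h1 : ENNReal.ofReal M ≤ W x₀ := by
      have h2 : ENNReal.ofReal M = ENNReal.ofReal m + ENNReal.ofReal (M - V x₀) := by
        rw [← ENNReal.ofReal_add hm.le (sub_nonneg.2 (hVM x₀).le), hVm]
        congr 1
        ring
      rw [h2]
      exact add_le_add (hUδ x₀ h.symm) le_rfl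
    have := (ENNReal.ofReal_le_ofReal_iff hMη.le).1 (h1.trans hWx₀)
    linarith
  have hx₀R : ‖x₀‖ < R := by
    refine lt_of_le_of_ne (by simpa using hx₀A.1) fun h => ?_
    have hVη : V x₀ < η := by simpa only [hV, regPower, h] using hR
    have h1 : ENNReal.ofReal (M - V x₀) ≤ ENNReal.ofReal (M - η) := le_add_self.trans hWx₀
    have := (ENNReal.ofReal_le_ofReal_iff hMη.le).1 h1
    linarith
  obtain ⟨r, hr, hball⟩ : ∃ r > 0, Metric.ball x₀ r ⊆ A := by
    have h1 : IsOpen {y : EuclideanSpace ℝ (Fin n) | δ < ‖y‖ ∧ ‖y‖ < R} :=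
      (isOpen_lt continuous_const continuous_norm).inter
        (isOpen_lt continuous_norm continuous_const)
    obtain ⟨r, hr, hball⟩ := Metric.isOpen_iff.1 h1 x₀ ⟨hx₀δ, hx₀R⟩
    exact ⟨r, hr, fun y hy => ⟨by simpa using (hball hy).2.le, (hball hy).1.le⟩⟩
  obtain ⟨C, hC⟩ := exists_lipschitzWith_regPowerGrad (E := EuclideanSpace ℝ (Fin n)) hε hb.le
  have hsub := mul_lt_setIntegral_ball_of_divergence_pos hn (contDiff_regPowerGrad hε b) hC
    (hasFDerivAt_regPower hε b) (x := x₀) hr (fun y hy => by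
      rw [divergence_regPowerGrad hε]
      have h1 := regPower_pos hε (b + 2) y
      have h2 : 0 < 2 * b + 2 - n := by
        by_contra! h
        have : (0 : ℝ) ≤ n * ε := by positivity
        nlinarith [sq_nonneg δ]
      have h3 : δ ^ 2 ≤ ‖y‖ ^ 2 := by
        have := (hball hy).2
        gcongr
        exact this
      have h4 : 0 < (2 * b + 2 - n) * ‖y‖ ^ 2 - n * ε := by nlinarith
      positivity)
  set B := Metric.ball (0 : EuclideanSpace ℝ (Fin n)) r with hB
  have hBV : ∫ y in B, (M - V (x₀ - y)) < volume.real B * (M - V x₀) := by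
    have h1 : IntegrableOn (fun _ : EuclideanSpace ℝ (Fin n) => M) B :=
      integrableOn_ball_of_continuous continuous_const _ _
    have h2 : IntegrableOn (fun y => V (x₀ - y)) B :=
      integrableOn_ball_of_continuous (by fun_prop) _ _
    rw [integral_sub h1 h2, setIntegral_const, smul_eq_mul, mul_sub]
    simp only [hV]
    rw [integral_const_mul, mul_left_comm]
    have := mul_lt_mul_of_pos_left hsub hK0
    linarith
  have hint : volume B * W x₀ ≤ volume B * U x₀ + ENNReal.ofReal (∫ y in B, (M - V (x₀ - y))) := by
    calc volume B * W x₀ = ∫⁻ y in B, W x₀ := by rw [setLIntegral_const, mul_comm]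
      _ ≤ ∫⁻ y in B, (U (x₀ - y) + ENNReal.ofReal (M - V (x₀ - y))) := by
          refine setLIntegral_mono' Metric.isOpen_ball.measurableSet fun y hy => ?_
          refine hmin (hball ?_)
          simpa [hB, dist_eq_norm] using hy
      _ = (∫⁻ y in B, U (x₀ - y)) + ∫⁻ y in B, ENNReal.ofReal (M - V (x₀ - y)) :=
          lintegral_add_right _ (by fun_prop)
      _ ≤ _ := by
          rw [← ofReal_integral_eq_lintegral_ofReal
            (integrableOn_ball_of_continuous (by fun_prop) _ _)
            (.of_forall fun y => sub_nonneg.2 (hVM _).le)]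
          exact add_le_add (hU.setLIntegral_le x₀ r hr) le_rfl
  simp only [hW] at hint
  rw [mul_add, ENNReal.add_le_add_iff_left (ENNReal.mul_ne_top measure_ball_lt_top.ne hUx₀),
    ← ofReal_measureReal measure_ball_lt_top.ne, ← ENNReal.ofReal_mul (by positivity)] at hint
  have hpos : 0 < volume.real B := ENNReal.toReal_pos (volume_ball_ne_zero hr)
    measure_ball_lt_top.ne
  have h0 : 0 < volume.real B * (M - V x₀) := mul_pos hpos (sub_pos.2 (hVM x₀))
  exact absurd hint (not_le.2 ((ENNReal.ofReal_lt_ofReal_iff h0).2 hBV))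

/-- Lower bound by the fundamental solution: a function dominating its ball averages and bounded
below by `m` on a sphere is bounded below outside the sphere by `m (δ / ‖x‖)^{2b}`
as soon as `2 b ≥ n - 2`. -/
theorem SuperMean.lower_bound (hn : 1 ≤ n) {U : EuclideanSpace ℝ (Fin n) → ℝ≥0∞}
    (hU : SuperMean U) {m δ b : ℝ} (hm : 0 < m) (hδ : 0 < δ) (hb : 0 ≤ b)
    (hb' : (n : ℝ) - 2 ≤ 2 * b)
    (hUδ : ∀ x, ‖x‖ = δ → ENNReal.ofReal m ≤ U x) (x : EuclideanSpace ℝ (Fin n)) (hx : δ ≤ ‖x‖) :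
    ENNReal.ofReal (m * (δ ^ 2) ^ b * (‖x‖ ^ 2) ^ (-b)) ≤ U x := by
  -- the strict barrier applies with exponent `b + η` and `ε = δ² η / n`; then `η` tends to `0`
  have hn0 : (0 : ℝ) < n := by exact_mod_cast hn
  have hx0 : 0 < ‖x‖ := hδ.trans_le hx
  have hcont : ContinuousAt (fun η : ℝ => m * (δ ^ 2 * η / n + δ ^ 2) ^ (b + η) *
      (δ ^ 2 * η / n + ‖x‖ ^ 2) ^ (-(b + η))) 0 := by
    refine ContinuousAt.mul (continuousAt_const.mul (ContinuousAt.rpow (by fun_prop) (by fun_prop)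
      (.inl ?_))) (ContinuousAt.rpow (by fun_prop) (by fun_prop) (.inl ?_)) <;>
    · simp only [mul_zero, zero_div, zero_add]
      positivity
  have hlim : Filter.Tendsto (fun η : ℝ => ENNReal.ofReal (m * (δ ^ 2 * η / n + δ ^ 2) ^ (b + η) *
      (δ ^ 2 * η / n + ‖x‖ ^ 2) ^ (-(b + η)))) (nhdsWithin 0 (Ioi 0))
      (nhds (ENNReal.ofReal (m * (δ ^ 2) ^ b * (‖x‖ ^ 2) ^ (-b)))) := by
    have := (ENNReal.continuous_ofReal.continuousAt.comp hcont).tendsto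
    simp only [Function.comp_def, mul_zero, zero_div, zero_add, add_zero] at this
    exact this.mono_left nhdsWithin_le_nhds
  refine le_of_tendsto hlim ?_
  filter_upwards [self_mem_nhdsWithin] with η (hη : 0 < η)
  refine hU.barrier_le hn hm hδ (by positivity) (by linarith) ?_ hUδ x hx
  rw [mul_div_cancel₀ _ hn0.ne']
  have : 0 < δ ^ 2 := by positivity
  nlinarith

theorem SuperMean.translate {U : EuclideanSpace ℝ (Fin n) → ℝ≥0∞} (hU : SuperMean U)
    (z : EuclideanSpace ℝ (Fin n)) : SuperMean fun x => U (x + z) := by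
  refine ⟨hU.lowerSemicontinuous.comp (continuous_add_const z), fun x r hr => ?_⟩
  simpa only [sub_add_eq_add_sub] using hU.setLIntegral_le (x + z) r hr

/-- In dimension at most two the fundamental solution does not decay, and a function dominating
its ball averages is constant. -/
theorem SuperMean.eq_of_le_two (hn : 1 ≤ n) (hn2 : n ≤ 2)
    {U : EuclideanSpace ℝ (Fin n) → ℝ≥0∞} (hU : SuperMean U) (x z : EuclideanSpace ℝ (Fin n)) :
    U x = U z := by
  have key : ∀ x z, U z ≤ U x := by
    intro x z
    rcases eq_or_ne x z with rfl | hxz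
    · exact le_rfl
    refine le_of_forall_lt_imp_le_of_dense fun c hc => ?_
    rcases eq_or_ne c 0 with rfl | hc0
    · exact zero_le
    have hct : c ≠ ∞ := (hc.trans_le le_top).ne
    obtain ⟨r, hr, hball⟩ := Metric.eventually_nhds_iff_ball.1 (hU.lowerSemicontinuous z c hc)
    have hxz' : 0 < ‖x - z‖ := norm_pos_iff.2 (sub_ne_zero.2 hxz)
    have hn2' : (n : ℝ) ≤ 2 := by exact_mod_cast hn2
    -- with `b = 0` the lower bound `c` near `z` propagates to the whole space
    have := (hU.translate z).lower_bound hn (m := c.toReal) (δ := min (r / 2) ‖x - z‖) (b := 0)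
      (ENNReal.toReal_pos hc0 hct) (by positivity) le_rfl (by linarith) (fun y hy => by
        rw [ENNReal.ofReal_toReal hct]
        refine (hball _ ?_).le
        rw [Metric.mem_ball, dist_eq_norm, add_sub_cancel_right, hy]
        exact (min_le_left _ _).trans_lt (by linarith)) (x - z) (min_le_right _ _)
    simpa [ENNReal.ofReal_toReal hct] using this
  exact le_antisymm (key z x) (key x z)

theorem SuperMean.exists_lower_bound (hn : 3 ≤ n)
    {U : EuclideanSpace ℝ (Fin n) → ℝ≥0∞} (hU : SuperMean U) {z : EuclideanSpace ℝ (Fin n)}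
    (hz : U z ≠ 0) : ∃ c R : ℝ, 0 < c ∧ 0 < R ∧ ∀ x : EuclideanSpace ℝ (Fin n), R ≤ ‖x‖ →
      ENNReal.ofReal (c * ‖x‖ ^ (2 - (n : ℝ))) ≤ U x := by
  have hn' : (3 : ℝ) ≤ n := by exact_mod_cast hn
  obtain ⟨m, hm0, hmz⟩ := ENNReal.lt_iff_exists_nnreal_btwn.1 (pos_iff_ne_zero.2 hz)
  have hm0' : 0 < (m : ℝ) := by simpa using hm0
  obtain ⟨r, hr, hball⟩ := Metric.eventually_nhds_iff_ball.1 (hU.lowerSemicontinuous z m hmz)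
  set b : ℝ := ((n : ℝ) - 2) / 2 with hb
  have hb0 : 0 < b := by rw [hb]; linarith
  set δ := r / 2 with hδ
  have hδ0 : 0 < δ := by positivity
  refine ⟨m * (δ ^ 2) ^ b * (2 : ℝ) ^ (2 - (n : ℝ)), ‖z‖ + δ, by positivity, by positivity,
    fun x hx => ?_⟩
  have hxz : δ ≤ ‖x - z‖ := by linarith [norm_sub_norm_le x z]
  have hxz' : ‖x - z‖ ≤ 2 * ‖x‖ := by linarith [norm_sub_le x z]
  have := (hU.translate z).lower_bound (by omega) (m := m) (δ := δ) (b := b) hm0' hδ0 hb0.le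
    (by rw [hb]; linarith) (fun y hy => by
        rw [ENNReal.ofReal_coe_nnreal]
        refine (hball _ ?_).le
        rw [Metric.mem_ball, dist_eq_norm, add_sub_cancel_right, hy]
        linarith) (x - z) hxz
  rw [sub_add_cancel] at this
  refine le_trans (ENNReal.ofReal_le_ofReal ?_) this
  rw [mul_assoc]
  gcongr
  rw [norm_sq_rpow _ _ (norm_nonneg _), show 2 * -b = 2 - (n : ℝ) by rw [hb]; ring,
    ← Real.mul_rpow (by norm_num) (norm_nonneg _)]
  exact Real.rpow_le_rpow_of_nonpos (by linarith) hxz' (by linarith)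

theorem IsNonconstantFixedPoint.three_le (hn : 1 ≤ n) {f : EuclideanSpace ℝ (Fin n) → ℝ}
    (hf : IsNonconstantFixedPoint f) : 3 ≤ n := by
  by_contra! h
  obtain ⟨hU, hae⟩ := hf.superMean
  refine hf.2.2 ⟨(centeredMaximal f 0).toReal, ?_⟩
  filter_upwards [hae] with x hx
  rw [← hU.eq_of_le_two hn (by omega) x 0, ← hx.1, ENNReal.toReal_ofReal hx.2]

/-- In dimension at least three a non-constant fixed point dominates a multiple of `‖x‖^{2-n}` near
infinity. -/
theorem IsNonconstantFixedPoint.exists_lower_bound (hn : 3 ≤ n)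
    {f : EuclideanSpace ℝ (Fin n) → ℝ} (hf : IsNonconstantFixedPoint f) :
    ∃ c R : ℝ, 0 < c ∧ 0 < R ∧ ∀ᵐ x : EuclideanSpace ℝ (Fin n), R ≤ ‖x‖ →
      ENNReal.ofReal (c * ‖x‖ ^ (2 - (n : ℝ))) ≤ ‖f x‖ₑ := by
  obtain ⟨hU, hae⟩ := hf.superMean
  obtain ⟨z, hz⟩ : ∃ z, centeredMaximal f z ≠ 0 := by
    by_contra! h
    refine hf.2.2 ⟨0, ?_⟩
    filter_upwards [hae] with x hx
    have := hx.1
    rw [h x, ENNReal.ofReal_eq_zero] at this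
    exact le_antisymm this hx.2
  obtain ⟨c, R, hc, hR, h⟩ := hU.exists_lower_bound hn hz
  refine ⟨c, R, hc, hR, ?_⟩
  filter_upwards [hae] with x hx hxR
  rw [Real.enorm_of_nonneg hx.2, hx.1]
  exact h x hxR

end FixedPoints

/-! ### The equivalent conditions -/

section Equivalences

variable {n : ℕ}

theorem exists_mem_isNonconstantFixedPoint_iff (hn : 3 ≤ n)
    (X : RINorm (volume : Measure (EuclideanSpace ℝ (Fin n)))) :
    (∃ f, X.Mem f ∧ IsNonconstantFixedPoint f) ↔ X.toFun (newtonProfile n) < ∞ := by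
  constructor
  · rintro ⟨f, hXf, hf⟩
    obtain ⟨c, R, hc, hR, h⟩ := hf.exists_lower_bound hn
    exact toFun_newtonProfile_lt_top hn X hXf.1.enorm hc hR h hXf.2
  · intro h
    refine ⟨_, ⟨(continuous_regPower one_pos _).aestronglyMeasurable, ?_⟩,
      isNonconstantFixedPoint_regPower hn⟩
    convert h using 2
    ext x
    exact Real.enorm_of_nonneg (regPower_pos one_pos _ x).le

theorem mem_indicator_norm_rpow_iff (hn : 3 ≤ n)
    (X : RINorm (volume : Measure (EuclideanSpace ℝ (Fin n)))) :
    X.Mem ({x | 1 < ‖x‖}.indicator fun x => ‖x‖ ^ (2 - (n : ℝ))) ↔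
      X.toFun (newtonProfile n) < ∞ := by
  have hm : Measurable ({x : EuclideanSpace ℝ (Fin n) | 1 < ‖x‖}.indicator
      fun x => ‖x‖ ^ (2 - (n : ℝ))) :=
    Measurable.indicator (by fun_prop) (measurableSet_lt measurable_const measurable_norm)
  constructor
  · intro h
    refine toFun_newtonProfile_lt_top hn X hm.enorm.aemeasurable one_pos two_pos
      (.of_forall fun x hx => ?_) h.2
    rw [indicator_of_mem (show x ∈ {x | 1 < ‖x‖} by simp only [mem_ofPred_eq]; linarith), one_mul,
      Real.enorm_of_nonneg (by positivity)]
  · intro h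
    refine ⟨hm.aestronglyMeasurable, toFun_lt_top_of_newtonProfile hn X hm.enorm.aemeasurable
      (c := 1) (d := 1) le_rfl (.of_forall fun x _ => ?_) (.of_forall fun x hx => ?_) h⟩
    · rw [one_mul, ← Real.enorm_of_nonneg (by positivity)]
      exact enorm_indicator_le_enorm_self _ _
    · rw [indicator_of_notMem (by simpa using hx.le)]
      simp

/-- The function `χ_[0,1] + t^{2/n-1} χ_[1,∞)` on the half-line. -/
noncomputable def halfLineProfile (n : ℕ) (t : ℝ) : ℝ :=
  (Icc (0 : ℝ) 1).indicator (fun _ => (1 : ℝ)) t +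
    (Ici (1 : ℝ)).indicator (fun s => s ^ (2 / (n : ℝ) - 1)) t

theorem measurable_halfLineProfile : Measurable (halfLineProfile n) := by
  unfold halfLineProfile
  exact (measurable_const.indicator measurableSet_Icc).add
    (Measurable.indicator (by fun_prop) measurableSet_Ici)

theorem halfLineProfile_nonneg (t : ℝ) : 0 ≤ halfLineProfile n t := by
  refine add_nonneg (indicator_nonneg (fun _ _ => zero_le_one) t) (indicator_nonneg ?_ t)
  intro s (hs : 1 ≤ s)
  positivity

theorem one_le_halfLineProfile {t : ℝ} (ht0 : 0 ≤ t) (ht : t ≤ 1) : 1 ≤ halfLineProfile n t := by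
  rw [halfLineProfile, indicator_of_mem (show t ∈ Icc (0 : ℝ) 1 from ⟨ht0, ht⟩)]
  refine le_add_of_nonneg_right (indicator_nonneg ?_ t)
  intro s (hs : 1 ≤ s)
  positivity

theorem rpow_le_halfLineProfile {t : ℝ} (ht : 1 ≤ t) :
    t ^ (2 / (n : ℝ) - 1) ≤ halfLineProfile n t := by
  rw [halfLineProfile, indicator_of_mem (show t ∈ Ici (1 : ℝ) from ht)]
  exact le_add_of_nonneg_left (indicator_nonneg (fun _ _ => zero_le_one) t)

theorem two_div_sub_one_nonpos (hn : 3 ≤ n) : 2 / (n : ℝ) - 1 ≤ 0 := by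
  have hn' : (3 : ℝ) ≤ n := by exact_mod_cast hn
  rw [sub_nonpos, div_le_one (by linarith)]
  linarith

/-- The factor `2` accounts for the overlap of the two indicators at `t = 1`. -/
theorem halfLineProfile_le_two_mul_rpow {t : ℝ} (ht : 1 ≤ t) :
    halfLineProfile n t ≤ 2 * t ^ (2 / (n : ℝ) - 1) := by
  rw [halfLineProfile, indicator_of_mem (show t ∈ Ici (1 : ℝ) from ht), two_mul]
  gcongr
  by_cases h : t ∈ Icc (0 : ℝ) 1
  · rw [indicator_of_mem h, le_antisymm h.2 ht]
    simp
  · rw [indicator_of_notMem h]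
    positivity

theorem halfLineProfile_le_two (hn : 3 ≤ n) (t : ℝ) : halfLineProfile n t ≤ 2 := by
  have h1 : (Icc (0 : ℝ) 1).indicator (fun _ => (1 : ℝ)) t ≤ 1 :=
    indicator_le' (fun _ _ => le_rfl) (fun _ _ => zero_le_one) t
  have h2 : (Ici (1 : ℝ)).indicator (fun s => s ^ (2 / (n : ℝ) - 1)) t ≤ 1 :=
    indicator_le' (g := fun _ => 1)
      (fun s hs => Real.rpow_le_one_of_one_le_of_nonpos hs (two_div_sub_one_nonpos hn))
      (fun _ _ => zero_le_one) t
  rw [halfLineProfile]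
  linarith

theorem ballVolume_rpow (hn : 1 ≤ n) (x : EuclideanSpace ℝ (Fin n)) :
    ballVolume x ^ (2 / (n : ℝ) - 1) =
      volume.real (Metric.ball (0 : EuclideanSpace ℝ (Fin n)) 1) ^ (2 / (n : ℝ) - 1) *
        ‖x‖ ^ (2 - (n : ℝ)) := by
  have hn' : (n : ℝ) ≠ 0 := by positivity
  rw [ballVolume, Real.mul_rpow (volume_unitBall_pos n).le (by positivity), ← Real.rpow_natCast,
    ← Real.rpow_mul (norm_nonneg _)]
  congr 2
  field_simp

/-- Composed with the volume of the ball of radius `‖x‖`, the profile on the half-line is comparable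
to `‖x‖^{2-n}` near infinity. -/
theorem halfLineProfile_mem_iff (hn : 3 ≤ n)
    (X : RINorm (volume : Measure (EuclideanSpace ℝ (Fin n)))) {Xbar : RINorm volumeHalfLine}
    (hX : IsRepresentation X Xbar) :
    Xbar.Mem (halfLineProfile n) ↔ X.toFun (newtonProfile n) < ∞ := by
  have hm := measurable_halfLineProfile (n := n)
  have hω := volume_unitBall_pos n
  set ω := volume.real (Metric.ball (0 : EuclideanSpace ℝ (Fin n)) 1) with hωdef
  have hcomp := hX.toFun_comp (measurePreserving_ballVolume (by omega))
    (g := fun t => ‖halfLineProfile n t‖ₑ) hm.enorm.aemeasurable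
  have hm' : AEMeasurable (fun x : EuclideanSpace ℝ (Fin n) =>
      ‖halfLineProfile n (ballVolume x)‖ₑ) :=
    (hm.comp measurable_ballVolume).enorm.aemeasurable
  have hMem : Xbar.Mem (halfLineProfile n) ↔
      X.toFun (fun x => ‖halfLineProfile n (ballVolume x)‖ₑ) < ∞ := by
    rw [hcomp]
    exact and_iff_right hm.aestronglyMeasurable
  rw [hMem]
  have hlarge : ∀ x : EuclideanSpace ℝ (Fin n), 1 + ω⁻¹ ≤ ‖x‖ → 1 ≤ ballVolume x := by
    intro x hx
    have h0 : 0 < ω⁻¹ := by positivity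
    have h1 : ‖x‖ ≤ ‖x‖ ^ n := le_self_pow₀ (by linarith) (by omega)
    have h2 : ω⁻¹ ≤ ‖x‖ ^ n := by linarith
    rw [ballVolume, ← hωdef]
    calc 1 = ω * ω⁻¹ := (mul_inv_cancel₀ hω.ne').symm
      _ ≤ _ := by gcongr
  constructor
  · intro h
    refine toFun_newtonProfile_lt_top hn X hm' (c := ω ^ (2 / (n : ℝ) - 1)) (R := 1 + ω⁻¹)
      (by positivity) (by positivity) (.of_forall fun x hx => ?_) h
    rw [Real.enorm_of_nonneg (halfLineProfile_nonneg _), ← ballVolume_rpow (by omega)]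
    exact ENNReal.ofReal_le_ofReal (rpow_le_halfLineProfile (hlarge x hx))
  · intro h
    refine toFun_lt_top_of_newtonProfile hn X hm' (c := 2 * ω ^ (2 / (n : ℝ) - 1)) (d := 2)
      (R := 1 + ω⁻¹) (le_add_of_nonneg_right (by positivity)) (.of_forall fun x hx => ?_)
      (.of_forall fun x _ => ?_) h
    · rw [Real.enorm_of_nonneg (halfLineProfile_nonneg _), mul_assoc, ← ballVolume_rpow (by omega)]
      exact ENNReal.ofReal_le_ofReal (halfLineProfile_le_two_mul_rpow (hlarge x hx))
    · rw [Real.enorm_of_nonneg (halfLineProfile_nonneg _)]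
      exact ENNReal.ofReal_le_ofReal (halfLineProfile_le_two hn _)

theorem one_div_weak_exponent (hn : 3 ≤ n) :
    1 / ((n : ℝ) / ((n : ℝ) - 2)) = -(2 / (n : ℝ) - 1) := by
  have hn' : (3 : ℝ) ≤ n := by exact_mod_cast hn
  field_simp
  ring

theorem one_lt_weak_exponent (hn : 3 ≤ n) : 1 < (n : ℝ) / ((n : ℝ) - 2) := by
  have hn' : (3 : ℝ) ≤ n := by exact_mod_cast hn
  rw [one_lt_div (by linarith)]
  linarith

theorem memLp_top_regPower (hn : 3 ≤ n) :
    MemLp (regPower 1 (((n : ℝ) - 2) / 2) : EuclideanSpace ℝ (Fin n) → ℝ) ∞ := by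
  have hn' : (3 : ℝ) ≤ n := by exact_mod_cast hn
  refine memLp_top_of_bound (continuous_regPower one_pos _).aestronglyMeasurable 1
    (.of_forall fun x => ?_)
  rw [Real.norm_of_nonneg (regPower_pos one_pos _ x).le]
  exact regPower_le_one (by linarith) x

/-- The function `(1 + ‖x‖²)^{(2 - n)/2}` is at most a multiple of `t^{2/n-1}`, where `t` is the
volume of the ball of radius `‖x‖`, and composition with that volume preserves rearrangements. -/
theorem memWeakLp_regPower (hn : 3 ≤ n) :
    MemWeakLp (regPower 1 (((n : ℝ) - 2) / 2) : EuclideanSpace ℝ (Fin n) → ℝ)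
      ((n : ℝ) / ((n : ℝ) - 2)) volume := by
  have hn' : (3 : ℝ) ≤ n := by exact_mod_cast hn
  have hω := volume_unitBall_pos n
  set ω := volume.real (Metric.ball (0 : EuclideanSpace ℝ (Fin n)) 1) with hωdef
  set a := 2 / (n : ℝ) - 1 with ha
  have : Nontrivial (EuclideanSpace ℝ (Fin n)) := by
    refine Module.nontrivial_of_finrank_pos (R := ℝ) ?_
    rw [finrank_euclideanSpace_fin]
    omega
  refine ⟨(continuous_regPower one_pos _).aestronglyMeasurable,
    lt_of_le_of_lt (b := ENNReal.ofReal (ω ^ (-a))) (iSup₂_le fun t ht => ?_)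
      ENNReal.ofReal_lt_top⟩
  set g : ℝ → ℝ≥0∞ := fun t => ENNReal.ofReal (ω ^ (-a) * t ^ a) with hg
  have hgm : Measurable g := by fun_prop
  have hganti : AntitoneOn g (Ioi 0) := by
    intro s hs t _ hst
    refine ENNReal.ofReal_le_ofReal (mul_le_mul_of_nonneg_left ?_ (by positivity))
    exact Real.rpow_le_rpow_of_nonpos hs hst (two_div_sub_one_nonpos hn)
  have hle : rearrangement (volume : Measure (EuclideanSpace ℝ (Fin n)))
      (fun x => ‖regPower 1 (((n : ℝ) - 2) / 2) x‖ₑ) t ≤ g t := by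
    calc _ ≤ rearrangement (volume : Measure (EuclideanSpace ℝ (Fin n)))
          (fun x => g (ballVolume x)) t := by
          refine rearrangement_mono ?_ t
          have hae : ∀ᵐ x : EuclideanSpace ℝ (Fin n), x ≠ 0 := by simp [ae_iff]
          filter_upwards [hae] with x hx
          rw [Real.enorm_of_nonneg (regPower_pos one_pos _ x).le]
          refine ENNReal.ofReal_le_ofReal ?_
          rw [ha, ballVolume_rpow (by omega), ← ha, ← mul_assoc, ← hωdef, ← Real.rpow_add hω,
            neg_add_cancel, Real.rpow_zero, one_mul]
          convert regPower_le_norm_rpow one_pos (b := ((n : ℝ) - 2) / 2) (by linarith)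
            (norm_pos_iff.2 hx) using 2
          ring
      _ = rearrangement volumeHalfLine g t := by
          rw [rearrangement_comp (measurePreserving_ballVolume (by omega)) hgm.aemeasurable]
      _ ≤ g t := rearrangement_le_of_antitoneOn hganti ht
  calc _ ≤ ENNReal.ofReal (t ^ (-a)) * g t := by
        rw [one_div_weak_exponent hn]
        gcongr
    _ = ENNReal.ofReal (ω ^ (-a)) := by
        rw [hg, ← ENNReal.ofReal_mul (by positivity), mul_left_comm, ← Real.rpow_add ht,
          neg_add_cancel, Real.rpow_zero, mul_one]

/-- A bounded function in weak `L^{n/(n-2)}` has its rearrangement dominated by a multiple of the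
profile on the half-line. -/
theorem forall_memWeakLp_mem_iff (hn : 3 ≤ n)
    (X : RINorm (volume : Measure (EuclideanSpace ℝ (Fin n)))) {Xbar : RINorm volumeHalfLine}
    (hX : IsRepresentation X Xbar) :
    (∀ f : EuclideanSpace ℝ (Fin n) → ℝ,
      MemWeakLp f ((n : ℝ) / ((n : ℝ) - 2)) volume → MemLp f ∞ volume → X.Mem f) ↔
        X.toFun (newtonProfile n) < ∞ := by
  constructor
  · intro h
    have := (h _ (memWeakLp_regPower hn) (memLp_top_regPower hn)).2
    convert this using 2
    ext x
    exact (Real.enorm_of_nonneg (regPower_pos one_pos _ x).le).symm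
  · intro h f hf hfb
    refine ⟨hf.1, ?_⟩
    have hXbar := ((halfLineProfile_mem_iff hn X hX).2 h).2
    set A := ⨆ (t : ℝ) (_ : 0 < t), ENNReal.ofReal (t ^ (1 / ((n : ℝ) / ((n : ℝ) - 2)))) *
      rearrangement volume (fun x => ‖f x‖ₑ) t with hA
    have hAtop : A + eLpNorm f ∞ volume ≠ ∞ := ENNReal.add_ne_top.2 ⟨hf.2.ne, hfb.2.ne⟩
    have hprof := (measurable_halfLineProfile (n := n)).enorm.aemeasurable (μ := volumeHalfLine)
    have hbound : ∀ t : ℝ, 0 < t → rearrangement volume (fun x => ‖f x‖ₑ) t ≤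
        (A + eLpNorm f ∞ volume) * ‖halfLineProfile n t‖ₑ := by
      intro t ht
      rw [Real.enorm_of_nonneg (halfLineProfile_nonneg t)]
      rcases le_total t 1 with ht1 | ht1
      · calc _ ≤ eLpNorm f ∞ volume * 1 := by
              rw [mul_one]
              exact rearrangement_le_eLpNorm_top f t
          _ ≤ _ := mul_le_mul' le_add_self
              (ENNReal.one_le_ofReal.2 (one_le_halfLineProfile ht.le ht1))
      · calc _ ≤ A * ENNReal.ofReal (t ^ (2 / (n : ℝ) - 1)) := by
              have h1 : ENNReal.ofReal (t ^ (1 / ((n : ℝ) / ((n : ℝ) - 2)))) *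
                  rearrangement volume (fun x => ‖f x‖ₑ) t ≤ A :=
                le_iSup₂ (f := fun (t : ℝ) (_ : 0 < t) =>
                  ENNReal.ofReal (t ^ (1 / ((n : ℝ) / ((n : ℝ) - 2)))) *
                    rearrangement volume (fun x => ‖f x‖ₑ) t) t ht
              rw [one_div_weak_exponent hn, Real.rpow_neg ht.le,
                ENNReal.ofReal_inv_of_pos (by positivity)] at h1
              rwa [← ENNReal.div_le_iff_le_mul
                (.inl (ENNReal.ofReal_pos.2 (by positivity)).ne') (.inl (by simp)),
                div_eq_mul_inv, mul_comm]
          _ ≤ _ := mul_le_mul' le_self_add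
              (ENNReal.ofReal_le_ofReal (rpow_le_halfLineProfile ht1))
    rw [hX _ hf.1.enorm]
    calc _ ≤ Xbar.toFun fun t => (A + eLpNorm f ∞ volume).toNNReal * ‖halfLineProfile n t‖ₑ := by
          refine Xbar.mono _ _ (measurable_rearrangement _).aemeasurable (by fun_prop) ?_
          filter_upwards [ae_restrict_mem measurableSet_Ioi] with t ht
          rw [ENNReal.coe_toNNReal hAtop]
          exact hbound t ht
      _ = (A + eLpNorm f ∞ volume).toNNReal * Xbar.toFun fun t => ‖halfLineProfile n t‖ₑ :=
          Xbar.smul _ _ hprof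
      _ < ∞ := ENNReal.mul_lt_top (by simp) hXbar

theorem measurable_rieszPotential {g : EuclideanSpace ℝ (Fin n) → ℝ≥0∞} (hg : Measurable g) :
    Measurable (rieszPotential g) := by
  unfold rieszPotential
  exact Measurable.lintegral_prod_right' (f := fun p : EuclideanSpace ℝ (Fin n) ×
    EuclideanSpace ℝ (Fin n) => ENNReal.ofReal (‖p.1 - p.2‖ ^ (2 - (n : ℝ))) * g p.2)
    (by fun_prop)

theorem rieszPotential_congr {g h : EuclideanSpace ℝ (Fin n) → ℝ≥0∞} (hgh : g =ᵐ[volume] h) :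
    rieszPotential g = rieszPotential h := by
  ext x
  refine lintegral_congr_ae ?_
  filter_upwards [hgh] with y hy
  rw [hy]

/-- The Riesz potential of a non-zero function decays no faster than `‖x‖^{2-n}`. -/
theorem exists_lower_bound_rieszPotential (hn : 3 ≤ n) {g : EuclideanSpace ℝ (Fin n) → ℝ≥0∞}
    (hg : ∫⁻ y, g y ≠ 0) :
    ∃ c R : ℝ, 0 < c ∧ 0 < R ∧ ∀ x : EuclideanSpace ℝ (Fin n), R ≤ ‖x‖ →
      ENNReal.ofReal (c * ‖x‖ ^ (2 - (n : ℝ))) ≤ rieszPotential g x := by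
  have hn' : (3 : ℝ) ≤ n := by exact_mod_cast hn
  obtain ⟨k, hk⟩ : ∃ k : ℕ, ∫⁻ y in Metric.ball 0 (k : ℝ), g y ≠ 0 := by
    by_contra! h
    have hmono : Monotone fun k : ℕ => Metric.ball (0 : EuclideanSpace ℝ (Fin n)) k :=
      fun i j hij => Metric.ball_subset_ball (by exact_mod_cast hij)
    refine hg ?_
    rw [← setLIntegral_univ, ← Metric.iUnion_ball_nat (0 : EuclideanSpace ℝ (Fin n)),
      setLIntegral_iUnion_of_directed _ hmono.directed_le]
    simp [h]
  obtain ⟨m, hm0, hmk⟩ := ENNReal.lt_iff_exists_nnreal_btwn.1 (pos_iff_ne_zero.2 hk)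
  have hm0' : 0 < (m : ℝ) := by simpa using hm0
  refine ⟨2 ^ (2 - (n : ℝ)) * m, k + 1, by positivity, by positivity, fun x hx => ?_⟩
  calc _ = ENNReal.ofReal ((2 * ‖x‖) ^ (2 - (n : ℝ))) * m := by
        rw [Real.mul_rpow zero_le_two (norm_nonneg _), mul_right_comm,
          ENNReal.ofReal_mul (by positivity), ENNReal.ofReal_coe_nnreal]
    _ ≤ ENNReal.ofReal ((2 * ‖x‖) ^ (2 - (n : ℝ))) * ∫⁻ y in Metric.ball 0 (k : ℝ), g y := by
        gcongr
    _ ≤ ∫⁻ y in Metric.ball 0 (k : ℝ), ENNReal.ofReal ((2 * ‖x‖) ^ (2 - (n : ℝ))) * g y :=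
        lintegral_const_mul_le _ _
    _ ≤ ∫⁻ y in Metric.ball 0 (k : ℝ), ENNReal.ofReal (‖x - y‖ ^ (2 - (n : ℝ))) * g y := by
        refine setLIntegral_mono' Metric.isOpen_ball.measurableSet fun y hy => ?_
        have hy' : ‖y‖ < k := by simpa using hy
        refine mul_le_mul' (ENNReal.ofReal_le_ofReal
          (Real.rpow_le_rpow_of_nonpos ?_ ?_ (by linarith))) le_rfl
        · linarith [norm_sub_norm_le x y]
        · linarith [norm_sub_le x y]
    _ ≤ _ := setLIntegral_le_lintegral _ _

theorem setLIntegral_norm_rpow_lt_top (hn : 1 ≤ n) (r : ℝ) :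
    ∫⁻ y in Metric.ball (0 : EuclideanSpace ℝ (Fin n)) r, ENNReal.ofReal (‖y‖ ^ (2 - (n : ℝ))) <
      ∞ := by
  have h : IntegrableOn (fun y : EuclideanSpace ℝ (Fin n) => ‖y‖ ^ (2 - (n : ℝ)))
      (Metric.ball 0 r) := by
    refine integrableOn_ball_of_norm_le_rpow (C := 1) (α := (n : ℝ) - 2) ?_ ?_
      (.of_forall fun y => ?_) (Measurable.aestronglyMeasurable (by fun_prop))
    · rwa [finrank_euclideanSpace_fin]
    · rw [finrank_euclideanSpace_fin]
      linarith
    · rw [Real.norm_of_nonneg (by positivity), one_mul, neg_sub]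
  refine lt_of_le_of_lt (lintegral_mono fun y => ?_) h.2
  rw [Real.enorm_of_nonneg (by positivity)]

theorem rieszPotential_indicator (x : EuclideanSpace ℝ (Fin n)) :
    rieszPotential ((Metric.ball 0 1).indicator fun _ => 1) x =
      ∫⁻ y in Metric.ball 0 1, ENNReal.ofReal (‖x - y‖ ^ (2 - (n : ℝ))) := by
  rw [← lintegral_indicator Metric.isOpen_ball.measurableSet]
  refine lintegral_congr fun y => ?_
  by_cases hy : y ∈ Metric.ball (0 : EuclideanSpace ℝ (Fin n)) 1
  · rw [indicator_of_mem hy, indicator_of_mem hy, mul_one]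
  · rw [indicator_of_notMem hy, indicator_of_notMem hy, mul_zero]

/-- The Riesz potential of the unit ball is bounded by a multiple of `‖x‖^{2-n}` outside the ball of
radius `2`, and by the integral of `‖y‖^{2-n}` over the ball of radius `3` inside it. -/
theorem toFun_rieszPotential_indicator_lt_top (hn : 3 ≤ n)
    (X : RINorm (volume : Measure (EuclideanSpace ℝ (Fin n))))
    (h : X.toFun (newtonProfile n) < ∞) :
    X.toFun (rieszPotential ((Metric.ball 0 1).indicator fun _ => 1)) < ∞ := by
  have hn' : (3 : ℝ) ≤ n := by exact_mod_cast hn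
  have hmeas : Measurable (rieszPotential
      ((Metric.ball (0 : EuclideanSpace ℝ (Fin n)) 1).indicator fun _ => 1)) :=
    measurable_rieszPotential (measurable_const.indicator Metric.isOpen_ball.measurableSet)
  refine toFun_lt_top_of_newtonProfile hn X hmeas.aemeasurable (R := 2)
    (c := volume.real (Metric.ball (0 : EuclideanSpace ℝ (Fin n)) 1) * 2⁻¹ ^ (2 - (n : ℝ)))
    (d := (∫⁻ y in Metric.ball (0 : EuclideanSpace ℝ (Fin n)) 3,
      ENNReal.ofReal (‖y‖ ^ (2 - (n : ℝ)))).toReal)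
    one_le_two (.of_forall fun x hx => ?_) (.of_forall fun x hx => ?_) h
  · rw [rieszPotential_indicator]
    calc _ ≤ ∫⁻ y in Metric.ball (0 : EuclideanSpace ℝ (Fin n)) 1,
          ENNReal.ofReal ((2⁻¹ * ‖x‖) ^ (2 - (n : ℝ))) := by
          refine setLIntegral_mono' Metric.isOpen_ball.measurableSet fun y hy => ?_
          have hy' : ‖y‖ < 1 := by simpa using hy
          refine ENNReal.ofReal_le_ofReal (Real.rpow_le_rpow_of_nonpos ?_ ?_ (by linarith))
          · linarith
          · linarith [norm_sub_norm_le x y]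
      _ = _ := by
          rw [setLIntegral_const, ← ofReal_measureReal measure_ball_lt_top.ne,
            ← ENNReal.ofReal_mul (by positivity), Real.mul_rpow (by norm_num) (norm_nonneg _)]
          congr 1
          ring
  · rw [rieszPotential_indicator,
      ENNReal.ofReal_toReal (setLIntegral_norm_rpow_lt_top (by omega) 3).ne,
      setLIntegral_ball_sub fun y => ENNReal.ofReal (‖y‖ ^ (2 - (n : ℝ)))]
    refine lintegral_mono_set (Metric.ball_subset_ball' ?_)
    rw [dist_zero_right]
    linarith

theorem rieszDomain_ne_singleton_iff (hn : 3 ≤ n)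
    (X : RINorm (volume : Measure (EuclideanSpace ℝ (Fin n)))) :
    rieszDomain X ≠ {0} ↔ X.toFun (newtonProfile n) < ∞ := by
  constructor
  · intro h
    have h0 : (0 : EuclideanSpace ℝ (Fin n) →ₘ[volume] ℝ) ∈ rieszDomain X := by
      have h1 : rieszPotential (fun y => ‖(0 : EuclideanSpace ℝ (Fin n) →ₘ[volume] ℝ) y‖ₑ) = 0 := by
        rw [rieszPotential_congr (h := 0)]
        · ext x
          simp [rieszPotential]
        · filter_upwards [AEEqFun.coeFn_zero (α := EuclideanSpace ℝ (Fin n)) (β := ℝ)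
            (μ := volume)] with y hy
          simp [hy]
      change X.toFun _ < ∞
      rw [h1, (X.eq_zero_iff 0 aemeasurable_const).2 (ae_eq_refl _)]
      exact ENNReal.zero_lt_top
    obtain ⟨f, hf, hf0⟩ : ∃ f ∈ rieszDomain X, f ≠ 0 := by
      by_contra! h'
      exact h (eq_singleton_iff_unique_mem.2 ⟨h0, h'⟩)
    have hfm : Measurable fun y => ‖f y‖ₑ := f.stronglyMeasurable.measurable.enorm
    obtain ⟨c, R, hc, hR, hlow⟩ := exists_lower_bound_rieszPotential hn (g := fun y => ‖f y‖ₑ) (by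
      intro h1
      rw [lintegral_eq_zero_iff hfm] at h1
      refine hf0 (AEEqFun.ext ?_)
      filter_upwards [h1, AEEqFun.coeFn_zero (α := EuclideanSpace ℝ (Fin n)) (β := ℝ)
        (μ := volume)] with y hy hy0
      rw [hy0]
      simpa using hy)
    exact toFun_newtonProfile_lt_top hn X (measurable_rieszPotential hfm).aemeasurable hc hR
      (.of_forall hlow) hf
  · intro h h'
    set s := Metric.ball (0 : EuclideanSpace ℝ (Fin n)) 1
    have hsm : AEStronglyMeasurable (s.indicator fun _ => (1 : ℝ)) volume :=
      (measurable_const.indicator Metric.isOpen_ball.measurableSet).aestronglyMeasurable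
    have hmem : AEEqFun.mk _ hsm ∈ rieszDomain X := by
      change X.toFun _ < ∞
      rw [rieszPotential_congr (h := s.indicator fun _ => 1)]
      · exact toFun_rieszPotential_indicator_lt_top hn X h
      · filter_upwards [AEEqFun.coeFn_mk _ hsm] with y hy
        rw [hy]
        by_cases hys : y ∈ s <;> simp [hys]
    rw [h', mem_singleton_iff] at hmem
    have hzero : (s.indicator fun _ => (1 : ℝ)) =ᵐ[volume] 0 :=
      (AEEqFun.coeFn_mk _ hsm).symm.trans (hmem ▸ AEEqFun.coeFn_zero)
    rw [indicator_ae_eq_zero] at hzero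
    refine volume_ball_ne_zero (n := n) one_pos ?_
    simpa [Function.support_const] using hzero

end Equivalences

theorem mainTheorem1 (n : ℕ) (hn : 1 ≤ n) :
    (∀ X : RINorm (volume : Measure (EuclideanSpace ℝ (Fin n))),
      (∃ Xbar : RINorm volumeHalfLine, IsRepresentation X Xbar) ∧
      ∀ Xbar : RINorm volumeHalfLine, IsRepresentation X Xbar →
        List.TFAE [
          ∃ f, X.Mem f ∧ IsNonconstantFixedPoint f,
          3 ≤ n ∧ X.Mem ({x | 1 < ‖x‖}.indicator fun x => ‖x‖ ^ (2 - (n : ℝ))),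
          3 ≤ n ∧ Xbar.Mem (fun t => (Icc (0 : ℝ) 1).indicator (fun _ => (1 : ℝ)) t +
            (Ici (1 : ℝ)).indicator (fun s => s ^ (2 / (n : ℝ) - 1)) t),
          3 ≤ n ∧ ∀ f : EuclideanSpace ℝ (Fin n) → ℝ,
            MemWeakLp f ((n : ℝ) / ((n : ℝ) - 2)) volume → MemLp f ∞ volume → X.Mem f,
          3 ≤ n ∧ rieszDomain X ≠ {0}]) ∧
    (3 ≤ n → ∃ X₀ : RINorm (volume : Measure (EuclideanSpace ℝ (Fin n))),
      (∀ f : EuclideanSpace ℝ (Fin n) → ℝ, X₀.Mem f ↔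
        MemWeakLp f ((n : ℝ) / ((n : ℝ) - 2)) volume ∧ MemLp f ∞ volume) ∧
      (∃ f, X₀.Mem f ∧ IsNonconstantFixedPoint f) ∧
      ∀ X : RINorm (volume : Measure (EuclideanSpace ℝ (Fin n))),
        (∃ f, X.Mem f ∧ IsNonconstantFixedPoint f) →
          ∀ f : EuclideanSpace ℝ (Fin n) → ℝ, X₀.Mem f → X.Mem f) := by
  have hrep : ∀ X : RINorm (volume : Measure (EuclideanSpace ℝ (Fin n))),
      ∃ Xbar : RINorm volumeHalfLine, IsRepresentation X Xbar := fun X =>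
    ⟨_, isRepresentation_map X (measurePreserving_ballVolume hn)⟩
  refine ⟨fun X => ⟨hrep X, fun Xbar hX => ?_⟩, fun hn3 => ?_⟩
  · by_cases hn3 : 3 ≤ n
    · have h1 := exists_mem_isNonconstantFixedPoint_iff hn3 X
      have h2 := mem_indicator_norm_rpow_iff hn3 X
      have h3 : Xbar.Mem (fun t => (Icc (0 : ℝ) 1).indicator (fun _ => (1 : ℝ)) t +
          (Ici (1 : ℝ)).indicator (fun s => s ^ (2 / (n : ℝ) - 1)) t) ↔
            X.toFun (newtonProfile n) < ∞ := halfLineProfile_mem_iff hn3 X hX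
      have h4 := forall_memWeakLp_mem_iff hn3 X hX
      have h5 := rieszDomain_ne_singleton_iff hn3 X
      rw [h1, h2, h3, h4, h5]
      simp only [hn3, true_and, List.TFAE, List.mem_cons, List.not_mem_nil, or_false, or_self,
        forall_eq]
    · have h1 : ¬ ∃ f, X.Mem f ∧ IsNonconstantFixedPoint f := fun ⟨f, _, hf⟩ =>
        hn3 (hf.three_le hn)
      simp only [hn3, h1, false_and, List.TFAE, List.mem_cons, List.not_mem_nil, or_false, or_self,
        forall_eq]
  · have hmem := mem_weakLpInter_iff (μ := (volume : Measure (EuclideanSpace ℝ (Fin n))))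
      (one_lt_weak_exponent hn3)
    refine ⟨weakLpInter volume _ (one_lt_weak_exponent hn3), hmem, ?_, fun X hX f hf => ?_⟩
    · exact ⟨_, (hmem _).2 ⟨memWeakLp_regPower hn3, memLp_top_regPower hn3⟩,
        isNonconstantFixedPoint_regPower hn3⟩
    · obtain ⟨Xbar, hXbar⟩ := hrep X
      exact (forall_memWeakLp_mem_iff hn3 X hXbar).2
        ((exists_mem_isNonconstantFixedPoint_iff hn3 X).1 hX) f ((hmem f).1 hf).1 ((hmem f).1 hf).2
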